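/- Let $\mathfrak A$ be a Karoubian (idempotent complete) $\mathbb Q$-linear symmetric monoidal category, with $\mathbb Q$-bilinear tensor product, in which every object has a dual, and let $k=\operatorname{End}_{\mathfrak A}(\mathbb 1)$, a commutative $\mathbb Q$-algebra. For an endomorphism $f$ of an object $Y$ let $\operatorname{tr}(f;Y)\in k$ be its trace, i.e. the composite $\mathbb 1\to Y\otimes Y^\vee\xrightarrow{f\otimes 1}Y\otimes Y^\vee\cong Y^\vee\otimes Y\to\mathbb 1$, and let $\Lambda^nY$ be the image of the antisymmetrizer $\frac1{n!}\sum_{\sigma\in\Sigma_n}\operatorname{sgn}(\sigma)\,\sigma$ on $Y^{\otimes n}$. Let $\Lambda(k)=1+t\,k[\![t]\!]$ be the $\lambda$-ring whose addition is the multiplication of power series and whose product $*$ and operations $\lambda^j$ are given by the universal polynomials determined by $$\prod_i(1+x_it)*\prod_j(1+y_jt)=\prod_{i,j}(1+x_iy_jt),\qquad \lambda^j\Bigl(\prod_i(1+x_it)\Bigr)=\prod_{i_1<\dots<i_j}(1+x_{i_1}\cdots x_{i_j}t).$$ For an element $x$ of a $\lambda$-ring put $\lambda_s(x)=\sum_n\lambda^n(x)s^n$;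 the Adams operations $\psi_n$, $n\ge1$, are defined by $$-s\,\frac{d\lambda_s(x)}{ds}\Big/\lambda_s(x)=\sum_{n\ge1}\psi_n(x)(-s)^n .$$ Let $G$ be a group (or a monoid), $X$ a representation of $G$ in $\mathfrak A$, i.e. an object with a homomorphism from $G$ to the monoid of its endomorphisms, and let $g\in G$. Put $$\overline\chi_X(g)=\sum_{n\ge0}\operatorname{tr}(g;\Lambda^nX)\,t^n\in\Lambda(k).$$ Then for every $n\ge1$ $$\overline\chi_X(g^n)=\psi_n\bigl(\overline\chi_X(g)\bigr)\quad\text{in }\Lambda(k),$$ and moreover, in $k[\![t]\!]$, $$-t\,\frac{d\overline\chi_X(g)}{dt}\Big/\overline\chi_X(g)=\sum_{n\ge1}\operatorname{tr}(g^n;X)(-t)^n .$$ -/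

import Mathlib

namespace LambdaSeries
universe u

open PowerSeries

section Ghost
variable {A : Type*} [CommRing A]

/-- The power series `-t f'(t) / f(t)`, for `f` with constant coefficient `1`. -/
noncomputable def negLogDeriv (f : A⟦X⟧) : A⟦X⟧ := -(X * d⁄dX A f) * invOfUnit f 1

/-- `w 1, w 2, …` are the power sums of `f`: `t f' = f · ∑_{n ≥ 1} (-1)^(n-1) w n tⁿ`. -/
def IsGhost (f : A⟦X⟧) (w : ℕ → A) : Prop :=
  X * d⁄dX A f = f * PowerSeries.mk fun n => if n = 0 then 0 else -((-1) ^ n * w n)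

/-- The power sums of `f`. -/
noncomputable def ghost (f : A⟦X⟧) (n : ℕ) : A := (-1) ^ n * coeff n (negLogDeriv f)

lemma neg_one_pow_mul_self_mul (n : ℕ) (a : A) : (-1) ^ n * ((-1) ^ n * a) = a := by
  rw [← mul_assoc, ← mul_pow]; simp

lemma isGhost_ghost {f : A⟦X⟧} (hf : constantCoeff f = 1) : IsGhost f (ghost f) := by
  have h : (PowerSeries.mk fun n => if n = 0 then (0 : A) else -((-1) ^ n * ghost f n)) =
      -negLogDeriv f := by
    ext n
    rw [coeff_mk, ghost, neg_one_pow_mul_self_mul]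
    split_ifs with h
    · subst h; simp [negLogDeriv]
    · rfl
  have hu : f * invOfUnit f 1 = 1 := mul_invOfUnit f 1 (by simpa using hf)
  rw [IsGhost, h, negLogDeriv]
  linear_combination (-(X * d⁄dX A f)) * hu

lemma IsGhost.eq_ghost {f : A⟦X⟧} (hf : constantCoeff f = 1) {w : ℕ → A} (h : IsGhost f w)
    {n : ℕ} (hn : n ≠ 0) : w n = ghost f n := by
  have hu : f * invOfUnit f 1 = 1 := mul_invOfUnit f 1 (by simpa using hf)
  have e : negLogDeriv f =
      -PowerSeries.mk fun n => if n = 0 then 0 else -((-1) ^ n * w n) := by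
    rw [negLogDeriv, h]
    linear_combination (-PowerSeries.mk fun n => if n = 0 then 0 else -((-1) ^ n * w n)) * hu
  rw [ghost, e]
  simp [hn, neg_one_pow_mul_self_mul]

/-- Newton's relations. -/
lemma isGhost_iff {f : A⟦X⟧} {w : ℕ → A} : IsGhost f w ↔ ∀ n : ℕ,
    coeff (n + 1) f * (n + 1) =
      ∑ p ∈ Finset.HasAntidiagonal.antidiagonal n, coeff p.1 f * ((-1) ^ p.2 * w (p.2 + 1)) := by
  have key : ∀ n, coeff (n + 1) (f * PowerSeries.mk fun n => if n = 0 then 0 else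
      -((-1) ^ n * w n)) =
      ∑ p ∈ Finset.HasAntidiagonal.antidiagonal n, coeff p.1 f * ((-1) ^ p.2 * w (p.2 + 1)) := by
    intro n
    rw [coeff_mul, Finset.Nat.sum_antidiagonal_succ']
    simp [pow_succ]
  constructor
  · intro h n
    rw [← key, ← h, coeff_succ_X_mul, coeff_derivative]
  · intro h
    ext n
    cases n with
    | zero => simp [coeff_mul]
    | succ n => rw [key, ← h, coeff_succ_X_mul, coeff_derivative]

lemma IsGhost.mul {f g : A⟦X⟧} {w v : ℕ → A} (hf : IsGhost f w) (hg : IsGhost g v) :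
    IsGhost (f * g) (w + v) := by
  have e : (PowerSeries.mk fun n => if n = 0 then (0 : A) else -((-1) ^ n * (w + v) n)) =
      (PowerSeries.mk fun n => if n = 0 then 0 else -((-1) ^ n * w n)) +
      (PowerSeries.mk fun n => if n = 0 then 0 else -((-1) ^ n * v n)) := by
    ext n
    simp only [coeff_mk, map_add, Pi.add_apply]
    split_ifs <;> ring
  rw [IsGhost] at hf hg ⊢
  rw [e, Derivation.leibniz]
  simp only [smul_eq_mul]
  linear_combination g * hf + f * hg

lemma IsGhost.one : IsGhost (1 : A⟦X⟧) 0 := by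
  rw [IsGhost]
  ext n
  simp

lemma IsGhost.prod {ι : Type*} (s : Finset ι) {f : ι → A⟦X⟧} {w : ι → ℕ → A}
    (h : ∀ i ∈ s, IsGhost (f i) (w i)) : IsGhost (∏ i ∈ s, f i) (∑ i ∈ s, w i) := by
  classical
  induction s using Finset.induction_on with
  | empty => simpa using IsGhost.one
  | insert a s ha ih =>
    rw [Finset.prod_insert ha, Finset.sum_insert ha]
    exact (h a (by simp)).mul (ih fun i hi => h i (by simp [hi]))

lemma IsGhost.congr {f : A⟦X⟧} {w v : ℕ → A} (hf : IsGhost f w) (h : ∀ n, n ≠ 0 → w n = v n) :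
    IsGhost f v := by
  rw [isGhost_iff] at hf ⊢
  intro n
  rw [hf]
  exact Finset.sum_congr rfl fun p _ => by rw [h _ (Nat.succ_ne_zero _)]

lemma IsGhost.one_add_C_mul_X (a : A) : IsGhost (1 + C a * X) (fun n => a ^ n) := by
  rw [isGhost_iff]
  intro n
  cases n with
  | zero => simp
  | succ n =>
    rw [Finset.Nat.sum_antidiagonal_succ, Finset.Nat.sum_antidiagonal_eq_sum_range_succ
      (fun i j => coeff (i+1) (1 + C a * X) * ((-1) ^ j * a ^ (j + 1)))]
    rw [Finset.sum_range_succ', Finset.sum_eq_zero]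
    · simp [coeff_one]; ring
    · intro i _; simp [coeff_one]

lemma IsGhost.rescale {f : A⟦X⟧} {w : ℕ → A} (h : IsGhost f w) (a : A) :
    IsGhost (rescale a f) (fun n => a ^ n * w n) := by
  rw [isGhost_iff] at h ⊢
  intro n
  rw [coeff_rescale, mul_assoc, h, Finset.mul_sum]
  refine Finset.sum_congr rfl fun p hp => ?_
  rw [← Finset.HasAntidiagonal.mem_antidiagonal.mp hp, coeff_rescale]
  ring

lemma IsGhost.map {B : Type*} [CommRing B] (φ : A →+* B) {f : A⟦X⟧} {w : ℕ → A}
    (h : IsGhost f w) : IsGhost (PowerSeries.map φ f) (fun n => φ (w n)) := by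
  rw [isGhost_iff] at h ⊢
  intro n
  have := congrArg φ (h n)
  simpa [map_sum] using this

/-- The power sums of index at most `n` depend only on the coefficients of index at most `n`. -/
lemma IsGhost.eq_of_coeff_eq {f g : A⟦X⟧} {w v : ℕ → A} (hf : IsGhost f w) (hg : IsGhost g v)
    (hf₀ : constantCoeff f = 1) {n : ℕ} (h : ∀ i ≤ n, coeff i f = coeff i g) :
    ∀ i, i ≠ 0 → i ≤ n → w i = v i := by
  intro i
  induction i using Nat.strong_induction_on with
  | _ i ih =>
    intro hi hin
    obtain ⟨m, rfl⟩ := Nat.exists_eq_succ_of_ne_zero hi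
    have h₁ := isGhost_iff.mp hf m
    have h₂ := isGhost_iff.mp hg m
    rw [Finset.Nat.sum_antidiagonal_eq_sum_range_succ
      (fun i j => coeff i f * ((-1) ^ j * w (j + 1))), Finset.sum_range_succ'] at h₁
    rw [Finset.Nat.sum_antidiagonal_eq_sum_range_succ
      (fun i j => coeff i g * ((-1) ^ j * v (j + 1))), Finset.sum_range_succ'] at h₂
    rw [← h _ hin, ← h 0 (Nat.zero_le _)] at h₂
    rw [h₂] at h₁
    have e : ∑ k ∈ Finset.range m, coeff (k + 1) g * ((-1) ^ (m - (k + 1)) * v (m - (k + 1) + 1)) =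
        ∑ k ∈ Finset.range m, coeff (k + 1) f * ((-1) ^ (m - (k + 1)) * w (m - (k + 1) + 1)) := by
      refine Finset.sum_congr rfl fun k hk => ?_
      have hk := Finset.mem_range.mp hk
      rw [h (k + 1) (by omega), ih _ (by omega) (by omega) (by omega)]
    rw [e] at h₁
    have h₃ := add_left_cancel h₁
    simp only [coeff_zero_eq_constantCoeff, hf₀, one_mul, Nat.sub_zero] at h₃
    have h₄ := congrArg (fun x => (-1) ^ m * x) h₃
    simpa only [neg_one_pow_mul_self_mul] using h₄.symm

variable [Algebra ℚ A]

/-- Over a `ℚ`-algebra, the coefficients of index at most `n` are determined by the power sums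
of index at most `n`. -/
lemma IsGhost.coeff_eq {f g : A⟦X⟧} {w v : ℕ → A} (hf : IsGhost f w) (hg : IsGhost g v)
    (hf₀ : constantCoeff f = 1) (hg₀ : constantCoeff g = 1) {n : ℕ}
    (h : ∀ i, i ≠ 0 → i ≤ n → w i = v i) : ∀ i ≤ n, coeff i f = coeff i g := by
  intro i
  induction i using Nat.strong_induction_on with
  | _ i ih =>
    intro hin
    rcases Nat.eq_zero_or_pos i with rfl | hi
    · simp [hf₀, hg₀]
    obtain ⟨m, rfl⟩ := Nat.exists_eq_succ_of_ne_zero hi.ne'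
    have h₁ := isGhost_iff.mp hf m
    have h₂ := isGhost_iff.mp hg m
    have hu : IsUnit ((m : A) + 1) := by
      have := (IsUnit.mk0 ((m : ℚ) + 1) (by positivity)).map (algebraMap ℚ A)
      simpa using this
    refine hu.mul_right_cancel ?_
    rw [h₁, h₂]
    refine Finset.sum_congr rfl fun p hp => ?_
    have hp := Finset.HasAntidiagonal.mem_antidiagonal.mp hp
    rw [ih p.1 (by omega) (by omega), h _ (Nat.succ_ne_zero _) (by omega)]

/-- Coefficients of the series with prescribed power sums. -/
noncomputable def ofGhostCoeff (w : ℕ → A) : ℕ → A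
  | 0 => 1
  | n + 1 => algebraMap ℚ A (n + 1)⁻¹ *
      ∑ i : Fin (n + 1), ofGhostCoeff w i * ((-1) ^ (n - i : ℕ) * w (n - i + 1))

/-- The series with constant coefficient `1` and prescribed power sums. -/
noncomputable def ofGhost (w : ℕ → A) : A⟦X⟧ := PowerSeries.mk (ofGhostCoeff w)

lemma constantCoeff_ofGhost (w : ℕ → A) : constantCoeff (ofGhost w) = 1 := by
  rw [← coeff_zero_eq_constantCoeff_apply, ofGhost, coeff_mk, ofGhostCoeff]

lemma isGhost_ofGhost (w : ℕ → A) : IsGhost (ofGhost w) w := by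
  rw [isGhost_iff]
  intro n
  rw [Finset.Nat.sum_antidiagonal_eq_sum_range_succ
    (fun i j => coeff i (ofGhost w) * ((-1) ^ j * w (j + 1))), Finset.sum_range, ofGhost,
    coeff_mk, ofGhostCoeff]
  have h : algebraMap ℚ A (n + 1)⁻¹ * ((n : A) + 1) = 1 := by
    have : ((n : A) + 1) = algebraMap ℚ A (n + 1) := by simp
    rw [this, ← map_mul, inv_mul_cancel₀ (by positivity), map_one]
  simp only [coeff_mk]
  rw [mul_right_comm, h, one_mul]

lemma IsGhost.eq_ofGhost {f : A⟦X⟧} {w : ℕ → A} (hf : IsGhost f w)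
    (hf₀ : constantCoeff f = 1) : f = ofGhost w := by
  ext n
  exact hf.coeff_eq (isGhost_ofGhost w) hf₀ (constantCoeff_ofGhost w) (n := n)
    (fun _ _ _ => rfl) n le_rfl

lemma coeff_ofGhost_congr {w v : ℕ → A} {n : ℕ} (h : ∀ i, i ≠ 0 → i ≤ n → w i = v i) :
    coeff n (ofGhost w) = coeff n (ofGhost v) :=
  (isGhost_ofGhost w).coeff_eq (isGhost_ofGhost v) (constantCoeff_ofGhost w)
    (constantCoeff_ofGhost v) h n le_rfl

lemma constantCoeff_map_eq_one {R S : Type*} [CommRing R] [CommRing S] (φ : R →+* S) {f : R⟦X⟧}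
    (hf : constantCoeff f = 1) : constantCoeff (PowerSeries.map φ f) = 1 := by
  rw [← coeff_zero_eq_constantCoeff_apply, coeff_map, coeff_zero_eq_constantCoeff_apply, hf,
    map_one]

lemma map_ofGhost {B : Type*} [CommRing B] [Algebra ℚ B] (φ : A →+* B) (w : ℕ → A) :
    PowerSeries.map φ (ofGhost w) = ofGhost fun n => φ (w n) :=
  ((isGhost_ofGhost w).map φ).eq_ofGhost
    (constantCoeff_map_eq_one φ (constantCoeff_ofGhost w))

lemma constantCoeff_prod_one_add {R ι : Type*} [CommRing R] (s : Finset ι) (x : ι → R) :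
    constantCoeff (∏ i ∈ s, (1 + C (x i) * X : R⟦X⟧)) = 1 := by
  rw [map_prod]
  simp

lemma coeff_prod_one_add {R ι : Type*} [CommRing R] (s : Finset ι) (x : ι → R) (k : ℕ) :
    coeff k (∏ i ∈ s, (1 + C (x i) * X : R⟦X⟧)) =
      ∑ t ∈ s.powersetCard k, ∏ i ∈ t, x i := by
  classical
  rw [Finset.prod_one_add, map_sum, Finset.powersetCard_eq_filter, Finset.sum_filter]
  refine Finset.sum_congr rfl fun t _ => ?_
  rw [Finset.prod_mul_distrib, Finset.prod_const, ← map_prod, coeff_C_mul, coeff_X_pow]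
  simp [eq_comm]

lemma map_ghost {R S : Type*} [CommRing R] [CommRing S] (φ : R →+* S) {f : R⟦X⟧}
    (hf : constantCoeff f = 1) {n : ℕ} (hn : n ≠ 0) :
    ghost (PowerSeries.map φ f) n = φ (ghost f n) :=
  (((isGhost_ghost hf).map φ).eq_ghost (constantCoeff_map_eq_one φ hf) hn).symm

lemma ghost_congr {R : Type*} [CommRing R] {f g : R⟦X⟧} (hf : constantCoeff f = 1)
    (hg : constantCoeff g = 1) {n : ℕ} (h : ∀ i ≤ n, coeff i f = coeff i g) {i : ℕ}
    (hi : i ≠ 0) (hin : i ≤ n) : ghost f i = ghost g i :=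
  (isGhost_ghost hf).eq_of_coeff_eq (isGhost_ghost hg) hf h i hi hin

lemma ghost_prod_one_add {R ι : Type*} [CommRing R] (s : Finset ι) (x : ι → R) {n : ℕ}
    (hn : n ≠ 0) : ghost (∏ i ∈ s, (1 + C (x i) * X : R⟦X⟧)) n = ∑ i ∈ s, x i ^ n := by
  rw [← (IsGhost.prod s fun i _ => IsGhost.one_add_C_mul_X (x i)).eq_ghost
    (constantCoeff_prod_one_add s x) hn]
  simp

/-- The principle that identifies universal polynomials: a natural operation on power series
with constant coefficient `1` that only involves the first `N` coefficients is given by the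
polynomial that gives it on `∏ (1 + xᵢ t)` in terms of the elementary symmetric polynomials. -/
lemma universal {A : Type u} [CommRing A] [Algebra ℚ A] (N : ℕ)
    (op : ∀ (B : Type u) [CommRing B] [Algebra ℚ B] [Algebra A B], B⟦X⟧ → B)
    (hnat : ∀ (B B' : Type u) [CommRing B] [Algebra ℚ B] [Algebra A B] [CommRing B']
      [Algebra ℚ B'] [Algebra A B'] (φ : B →ₐ[A] B') (f : B⟦X⟧), constantCoeff f = 1 →
      op B' (PowerSeries.map (φ : B →+* B') f) = φ (op B f))
    (hdep : ∀ g g' : A⟦X⟧, constantCoeff g = 1 → constantCoeff g' = 1 →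
      (∀ i ≤ N, coeff i g = coeff i g') → op A g = op A g')
    (P : MvPolynomial (Fin N) A)
    (hP : op (MvPolynomial (Fin N) A) (∏ i, (1 + C (MvPolynomial.X i) * X)) =
      MvPolynomial.aeval (fun i : Fin N => MvPolynomial.esymm (Fin N) A (i + 1)) P)
    (g : A⟦X⟧) (hg : constantCoeff g = 1) :
    op A g = MvPolynomial.aeval (fun i : Fin N => coeff (i + 1) g) P := by
  classical
  let Gu : (MvPolynomial (Fin N) A)⟦X⟧ := PowerSeries.mk fun k =>
    if k = 0 then 1 else if h : k - 1 < N then MvPolynomial.X ⟨k - 1, h⟩ else 0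
  have hGu : constantCoeff Gu = 1 := by
    rw [← coeff_zero_eq_constantCoeff_apply]; simp [Gu]
  let φ : MvPolynomial (Fin N) A →ₐ[A] MvPolynomial (Fin N) A :=
    MvPolynomial.aeval fun i : Fin N => MvPolynomial.esymm (Fin N) A (i + 1)
  have hφ : Function.Injective φ := by
    have h := Subtype.val_injective.comp
      (MvPolynomial.esymmAlgHom_injective (σ := Fin N) (n := N) A (by simp))
    have e : φ = (MvPolynomial.symmetricSubalgebra (Fin N) A).val.comp
        (MvPolynomial.esymmAlgHom (Fin N) A N) := by
      ext1 i
      simp [φ, MvPolynomial.esymmAlgHom]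
    rw [e]
    exact h
  have h₁ : PowerSeries.map (φ : _ →+* MvPolynomial (Fin N) A) Gu =
      ∏ i, (1 + C (MvPolynomial.X i) * X) := by
    ext1 k
    rw [coeff_prod_one_add, coeff_map]
    change _ = MvPolynomial.esymm (Fin N) A k
    simp only [Gu, coeff_mk]
    rcases Nat.eq_zero_or_pos k with rfl | hk
    · simp
    rw [if_neg hk.ne']
    split_ifs with h
    · simp [φ, Nat.sub_add_cancel hk]
    · rw [map_zero, MvPolynomial.esymm, Finset.powersetCard_eq_empty.mpr (by simp; omega)]
      simp
  have h₂ : op _ Gu = P := by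
    apply hφ
    have := hnat _ _ φ Gu hGu
    rw [← this, h₁, hP]
  let ψ : MvPolynomial (Fin N) A →ₐ[A] A :=
    MvPolynomial.aeval fun i : Fin N => coeff (i + 1) g
  have h₃ := hnat _ _ ψ Gu hGu
  rw [h₂] at h₃
  refine Eq.trans (hdep _ _ hg ?_ fun i hi => ?_) h₃
  · rw [← coeff_zero_eq_constantCoeff_apply, coeff_map]; simp [Gu]
  · rw [coeff_map]
    simp only [Gu, coeff_mk]
    rcases Nat.eq_zero_or_pos i with rfl | hk
    · simp [hg]
    · rw [if_neg hk.ne', dif_pos (by omega)]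
      simp [ψ, Nat.sub_add_cancel hk]

end Ghost

/-- `Λ(A)`: the power series over `A` with constant coefficient `1`. -/
@[ext] structure BigLambda (A : Type u) [CommRing A] where
  /-- The underlying power series. -/
  series : A⟦X⟧
  constantCoeff_series : constantCoeff series = 1

namespace BigLambda
section Operations
variable {A : Type u} [CommRing A]

/-- The coefficient of `tⁿ` in `∏_{j ≤ n} f(y_j t)`, a symmetric polynomial in `y_1, …, y_n`. -/
noncomputable def mulSymm (f : BigLambda A) (n : ℕ) :
    MvPolynomial.symmetricSubalgebra (Fin n) A :=
  ⟨coeff n (∏ j : Fin n, rescale (MvPolynomial.X j) (PowerSeries.map MvPolynomial.C f.series)), by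
    intro e
    have h := (coeff_map (MvPolynomial.rename (R := A) e).toRingHom n
      (∏ j : Fin n, rescale (MvPolynomial.X j) (PowerSeries.map MvPolynomial.C f.series))).symm
    refine h.trans (congrArg (coeff n) ?_)
    rw [map_prod]
    refine Fintype.prod_equiv e _ _ fun j => ?_
    ext1 k
    simp [coeff_rescale]⟩

/-- The polynomial in the elementary symmetric polynomials that equals `mulSymm f n`. -/
noncomputable def mulPoly (f : BigLambda A) (n : ℕ) : MvPolynomial (Fin n) A :=
  (MvPolynomial.esymmAlgEquiv (Fin n) A (Fintype.card_fin n)).symm (mulSymm f n)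

/-- The product of `Λ(A)`: formally, `f * ∏ (1 + y_j t) = ∏ f(y_j t)`, so that
`∏ (1 + x_i t) * ∏ (1 + y_j t) = ∏ (1 + x_i y_j t)`. -/
noncomputable instance : Mul (BigLambda A) where
  mul f g :=
    { series := PowerSeries.mk fun n =>
        MvPolynomial.aeval (fun i : Fin n => coeff (i + 1) g.series) (mulPoly f n)
      constantCoeff_series := by
        have h : mulSymm f 0 = 1 := by
          ext1
          simp [mulSymm]
        rw [← coeff_zero_eq_constantCoeff_apply, coeff_mk, mulPoly, h, map_one, map_one] }

/-- The coefficient of `tⁿ` in `∏ (1 + x_S t)`, where `S` runs through the subsets of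
`{1, …, n j}` with `j` elements and `x_S` is the product of the `x_i` with `i ∈ S`. -/
noncomputable def lamSymm (j n : ℕ) : MvPolynomial.symmetricSubalgebra (Fin (n * j)) ℤ :=
  ⟨coeff n (∏ S ∈ (Finset.univ : Finset (Fin (n * j))).powersetCard j,
      (1 + C (∏ i ∈ S, MvPolynomial.X i) * X)), by
    intro e
    refine (coeff_map (MvPolynomial.rename (R := ℤ) e).toRingHom n _).symm.trans
      (congrArg (coeff n) ?_)
    rw [map_prod]
    refine Finset.prod_equiv (Equiv.finsetCongr e) (fun S => by simp) fun S _ => ?_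
    simp [map_prod]⟩

/-- The universal polynomial that expresses `lamSymm j n` through the elementary symmetric
polynomials in `x_1, …, x_{n j}`. -/
noncomputable def lamPoly (j n : ℕ) : MvPolynomial (Fin (n * j)) ℤ :=
  (MvPolynomial.esymmAlgEquiv (Fin (n * j)) ℤ (Fintype.card_fin (n * j))).symm (lamSymm j n)

/-- The operation `λ^j` on `Λ(A)`: formally, `λ^j (∏ (1 + x_i t)) = ∏_{|S| = j} (1 + x_S t)`. -/
noncomputable def lamOp (j : ℕ) (f : BigLambda A) : BigLambda A where
  series := PowerSeries.mk fun n =>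
    MvPolynomial.eval₂Hom (Int.castRingHom A) (fun i : Fin (n * j) => coeff (i + 1) f.series)
      (lamPoly j n)
  constantCoeff_series := by
    have h : lamSymm j 0 = 1 := by
      ext1
      simp only [lamSymm, coeff_zero_eq_constantCoeff_apply]
      exact constantCoeff_prod_one_add _ _
    rw [← coeff_zero_eq_constantCoeff_apply, coeff_mk, lamPoly, h, map_one, map_one]

/-- The additive group of `Λ(A)` is multiplication of power series. -/
noncomputable instance : Add (BigLambda A) where
  add f g :=
    ⟨f.series * g.series, by rw [map_mul, f.constantCoeff_series, g.constantCoeff_series, one_mul]⟩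

noncomputable instance : Zero (BigLambda A) := ⟨⟨1, by simp⟩⟩

noncomputable instance : Neg (BigLambda A) where
  neg f := ⟨invOfUnit f.series 1, by simp⟩

noncomputable instance : One (BigLambda A) := ⟨⟨1 + X, by simp⟩⟩

lemma series_add (f g : BigLambda A) : (f + g).series = f.series * g.series := rfl

lemma series_zero : (0 : BigLambda A).series = 1 := rfl

lemma series_one : (1 : BigLambda A).series = 1 + X := rfl

lemma series_neg (f : BigLambda A) : (-f).series = invOfUnit f.series 1 := rfl

lemma coeff_mul (f g : BigLambda A) (n : ℕ) : coeff n (f * g).series =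
    MvPolynomial.aeval (fun i : Fin n => coeff (i + 1) g.series) (mulPoly f n) := by
  have h : (f * g).series = PowerSeries.mk fun n =>
    MvPolynomial.aeval (fun i : Fin n => coeff (i + 1) g.series) (mulPoly f n) := rfl
  rw [h, coeff_mk]

lemma coeff_lamOp (j : ℕ) (f : BigLambda A) (n : ℕ) : coeff n (lamOp j f).series =
    MvPolynomial.eval₂Hom (Int.castRingHom A) (fun i : Fin (n * j) => coeff (i + 1) f.series)
      (lamPoly j n) := by
  rw [lamOp, coeff_mk]

lemma aeval_esymm_eq {R : Type*} [CommRing R] {N : ℕ}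
    (F : MvPolynomial.symmetricSubalgebra (Fin N) R) :
    MvPolynomial.aeval (fun i : Fin N => MvPolynomial.esymm (Fin N) R (i + 1))
      ((MvPolynomial.esymmAlgEquiv (Fin N) R (Fintype.card_fin N)).symm F) = F.1 := by
  conv_rhs => rw [← (MvPolynomial.esymmAlgEquiv (Fin N) R (Fintype.card_fin N)).apply_symm_apply F]
  have e : (MvPolynomial.aeval (fun i : Fin N => MvPolynomial.esymm (Fin N) R (i + 1))) =
      (MvPolynomial.symmetricSubalgebra (Fin N) R).val.comp
        (MvPolynomial.esymmAlgEquiv (Fin N) R (Fintype.card_fin N)).toAlgHom := by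
    ext1 i
    simp [MvPolynomial.esymmAlgHom]
  rw [e]
  rfl

lemma ghost_add (f g : BigLambda A) {n : ℕ} (hn : n ≠ 0) :
    ghost (f + g).series n = ghost f.series n + ghost g.series n :=
  (((isGhost_ghost f.constantCoeff_series).mul
    (isGhost_ghost g.constantCoeff_series)).eq_ghost (f + g).constantCoeff_series hn).symm

lemma ghost_zero {n : ℕ} (hn : n ≠ 0) : ghost (0 : BigLambda A).series n = 0 :=
  (IsGhost.one.eq_ghost (0 : BigLambda A).constantCoeff_series hn).symm

lemma ghost_one {n : ℕ} (hn : n ≠ 0) : ghost (1 : BigLambda A).series n = 1 := by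
  have h := IsGhost.one_add_C_mul_X (1 : A)
  rw [map_one, one_mul] at h
  rw [← h.eq_ghost (1 : BigLambda A).constantCoeff_series hn, one_pow]

lemma neg_add_self (f : BigLambda A) : -f + f = 0 := by
  ext1
  exact invOfUnit_mul f.series 1 (by simp [f.constantCoeff_series])

variable [Algebra ℚ A]

/-- Over a `ℚ`-algebra, the product of `Λ(A)` is the product of power sums. -/
lemma series_mul (f g : BigLambda A) :
    (f * g).series = ofGhost fun m => ghost f.series m * ghost g.series m := by
  ext n
  rw [coeff_mul]
  refine (universal n (fun B _ _ _ h => coeff n (ofGhost fun m =>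
    algebraMap A B (ghost f.series m) * ghost h m)) ?_ ?_ (mulPoly f n) ?_ g.series
    g.constantCoeff_series).symm
  · intro B B' _ _ _ _ _ _ φ h hh
    change _ = (φ : B →+* B') _
    rw [← coeff_map, map_ofGhost]
    refine coeff_ofGhost_congr fun i hi _ => ?_
    rw [map_ghost _ hh hi, map_mul]
    congr 1
    exact (φ.commutes _).symm
  · intro h h' hh hh' e
    refine coeff_ofGhost_congr fun i hi hin => ?_
    rw [ghost_congr hh hh' e hi hin]
  · rw [mulPoly, aeval_esymm_eq, mulSymm]
    refine congrArg (coeff n) (Eq.symm ?_)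
    have key := IsGhost.prod Finset.univ fun (j : Fin n) _ =>
      (((isGhost_ghost f.constantCoeff_series).map
        (MvPolynomial.C (σ := Fin n))).rescale (MvPolynomial.X j))
    refine (key.congr fun m hm => ?_).eq_ofGhost ?_
    · rw [ghost_prod_one_add _ _ hm, Finset.sum_apply, Finset.mul_sum]
      exact Finset.sum_congr rfl fun j _ => mul_comm _ _
    · rw [map_prod]
      refine Finset.prod_eq_one fun j _ => ?_
      rw [← coeff_zero_eq_constantCoeff_apply, coeff_rescale, pow_zero, one_mul,
        coeff_zero_eq_constantCoeff_apply, constantCoeff_map_eq_one _ f.constantCoeff_series]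

/-- Over a `ℚ`-algebra, the power sum `w_m (λ^j f)` is the `j`-th elementary symmetric function
formed from the power sums `w_m f, w_{2m} f, …`. -/
lemma series_lamOp (j : ℕ) (f : BigLambda A) : (lamOp j f).series =
    ofGhost fun m => coeff j (ofGhost fun k => ghost f.series (m * k)) := by
  ext n
  rw [coeff_lamOp]
  have hZ : ∀ {B : Type u} [CommRing B] [Algebra A B] (b : Fin (n * j) → B),
      MvPolynomial.aeval b (MvPolynomial.map (Int.castRingHom A) (lamPoly j n)) =
        MvPolynomial.eval₂Hom (Int.castRingHom B) b (lamPoly j n) := by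
    intro B _ _ b
    rw [MvPolynomial.aeval_def, MvPolynomial.eval₂_map, MvPolynomial.coe_eval₂Hom]
    congr 1
    exact RingHom.ext_int _ _
  refine Eq.trans (hZ (fun i : Fin (n * j) => coeff (i + 1) f.series)).symm ?_
  refine (universal (n * j) (fun B _ _ _ h => coeff n (ofGhost fun m =>
    coeff j (ofGhost fun k => ghost h (m * k)))) ?_ ?_ _ ?_ f.series
    f.constantCoeff_series).symm
  · intro B B' _ _ _ _ _ _ φ h hh
    change _ = (φ : B →+* B') _
    rw [← coeff_map, map_ofGhost]
    refine coeff_ofGhost_congr fun i hi _ => ?_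
    rw [← coeff_map, map_ofGhost]
    refine coeff_ofGhost_congr fun k hk _ => ?_
    rw [map_ghost _ hh (Nat.mul_ne_zero hi hk)]
  · intro h h' hh hh' e
    refine coeff_ofGhost_congr fun i hi hin => coeff_ofGhost_congr fun k hk hkj => ?_
    exact ghost_congr hh hh' e (Nat.mul_ne_zero hi hk) (Nat.mul_le_mul hin hkj)
  · rw [hZ]
    have e₁ : MvPolynomial.eval₂Hom (Int.castRingHom _)
        (fun i : Fin (n * j) => MvPolynomial.esymm (Fin (n * j)) A (i + 1)) (lamPoly j n) =
        MvPolynomial.map (Int.castRingHom A) (lamSymm j n).1 := by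
      rw [← aeval_esymm_eq (lamSymm j n), ← lamPoly]
      refine RingHom.congr_fun (f := MvPolynomial.eval₂Hom (Int.castRingHom _) _)
        (g := (MvPolynomial.map (Int.castRingHom A)).comp (MvPolynomial.aeval
          fun i : Fin (n * j) => MvPolynomial.esymm (Fin (n * j)) ℤ (i + 1)).toRingHom)
        (MvPolynomial.ringHom_ext (fun r => ?_) fun i => ?_) (lamPoly j n)
      · simp
      · simp [MvPolynomial.map_esymm]
    rw [e₁, lamSymm, ← coeff_map]
    refine congrArg (coeff n) (Eq.symm ?_)
    rw [map_prod]
    have e₂ : ∀ S : Finset (Fin (n * j)), PowerSeries.map (MvPolynomial.map (Int.castRingHom A))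
        (1 + C (∏ i ∈ S, MvPolynomial.X i) * X) =
        (1 + C (∏ i ∈ S, (MvPolynomial.X i : MvPolynomial (Fin (n * j)) A)) * X) := by
      intro S
      simp [map_prod]
    rw [Finset.prod_congr rfl fun S _ => e₂ S]
    have key := isGhost_ghost (constantCoeff_prod_one_add
      ((Finset.univ : Finset (Fin (n * j))).powersetCard j) fun S =>
        ∏ i ∈ S, (MvPolynomial.X i : MvPolynomial (Fin (n * j)) A))
    refine (key.congr fun m hm => ?_).eq_ofGhost (constantCoeff_prod_one_add _ _)
    rw [ghost_prod_one_add _ _ hm]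
    have e₃ : (ofGhost fun k => ghost (∏ i, (1 + C (MvPolynomial.X i) * X)) (m * k)) =
        ∏ i : Fin (n * j), (1 + C ((MvPolynomial.X i : MvPolynomial (Fin (n * j)) A) ^ m) * X) := by
      refine (((isGhost_ghost (constantCoeff_prod_one_add _ _)).congr
        fun k hk => ?_).eq_ofGhost (constantCoeff_prod_one_add _ _)).symm
      rw [ghost_prod_one_add _ _ hk, ghost_prod_one_add _ _ (Nat.mul_ne_zero hm hk)]
      simp [pow_mul]
    rw [e₃, coeff_prod_one_add]
    exact Finset.sum_congr rfl fun S _ => (Finset.prod_pow _ _ _).symm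

lemma ext_ghost {f g : BigLambda A} (h : ∀ n, n ≠ 0 → ghost f.series n = ghost g.series n) :
    f = g := by
  ext1
  rw [((isGhost_ghost f.constantCoeff_series).congr h).eq_ofGhost f.constantCoeff_series,
    ← (isGhost_ghost g.constantCoeff_series).eq_ofGhost g.constantCoeff_series]

lemma ghost_mul (f g : BigLambda A) {n : ℕ} (hn : n ≠ 0) :
    ghost (f * g).series n = ghost f.series n * ghost g.series n := by
  rw [series_mul]
  exact ((isGhost_ofGhost _).eq_ghost (constantCoeff_ofGhost _) hn).symm

noncomputable instance : CommRing (BigLambda A) where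
  add_assoc f g h := by ext1; exact mul_assoc _ _ _
  zero_add f := by ext1; exact one_mul _
  add_zero f := by ext1; exact mul_one _
  add_comm f g := by ext1; exact mul_comm _ _
  neg_add_cancel f := neg_add_self f
  mul_assoc f g h := ext_ghost fun n hn => by simp only [ghost_mul _ _ hn, mul_assoc]
  one_mul f := ext_ghost fun n hn => by rw [ghost_mul _ _ hn, ghost_one hn, one_mul]
  mul_one f := ext_ghost fun n hn => by rw [ghost_mul _ _ hn, ghost_one hn, mul_one]
  mul_comm f g := ext_ghost fun n hn => by rw [ghost_mul _ _ hn, ghost_mul _ _ hn, mul_comm]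
  zero_mul f := ext_ghost fun n hn => by rw [ghost_mul _ _ hn, ghost_zero hn, zero_mul]
  mul_zero f := ext_ghost fun n hn => by rw [ghost_mul _ _ hn, ghost_zero hn, mul_zero]
  left_distrib f g h := ext_ghost fun n hn => by
    simp only [ghost_mul _ _ hn, ghost_add _ _ hn, mul_add]
  right_distrib f g h := ext_ghost fun n hn => by
    simp only [ghost_mul _ _ hn, ghost_add _ _ hn, add_mul]
  nsmul := nsmulRec
  zsmul := zsmulRec

end Operations
end BigLambda

/-- A `λ`-ring: a commutative ring with operations `λ^n` such that `λ^0 = 1`, `λ^1 = id` and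
`λ^n (x + y) = ∑_{i + j = n} λ^i x · λ^j y`. -/
class LambdaRing (R : Type u) extends CommRing R where
  /-- The operation `λ^n`. -/
  lam : ℕ → R → R
  lam_zero : ∀ x, lam 0 x = 1
  lam_one : ∀ x, lam 1 x = x
  lam_add : ∀ n x y, lam n (x + y) =
    ∑ p ∈ Finset.HasAntidiagonal.antidiagonal n, lam p.1 x * lam p.2 y

/-- The series `λ(x) = ∑ λ^n(x) tⁿ`. -/
noncomputable def LambdaRing.lamSeries {R : Type u} [LambdaRing R] (x : R) : R⟦X⟧ :=
  PowerSeries.mk fun n => LambdaRing.lam n x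

/-- The Adams operations: `-t (d/dt) λ(x) / λ(x) = ∑_{n ≥ 1} ψ_n(x) (-t)ⁿ`. -/
noncomputable def LambdaRing.adams {R : Type u} [LambdaRing R] (n : ℕ) (x : R) : R :=
  (-1) ^ n * coeff n (negLogDeriv (LambdaRing.lamSeries x))

/-- `Λ(A)` is a `λ`-ring. -/
noncomputable instance {A : Type u} [CommRing A] [Algebra ℚ A] : LambdaRing (BigLambda A) where
  lam := BigLambda.lamOp
  lam_zero f := BigLambda.ext_ghost fun n hn => by
    rw [BigLambda.ghost_one hn, BigLambda.series_lamOp,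
      ← (isGhost_ofGhost _).eq_ghost (constantCoeff_ofGhost _) hn,
      coeff_zero_eq_constantCoeff_apply, constantCoeff_ofGhost]
  lam_one f := BigLambda.ext_ghost fun n hn => by
    rw [BigLambda.series_lamOp,
      ← (isGhost_ofGhost _).eq_ghost (constantCoeff_ofGhost _) hn]
    have h := isGhost_iff.mp (isGhost_ofGhost fun k => ghost f.series (n * k)) 0
    simpa [constantCoeff_ofGhost] using h
  lam_add n f g := BigLambda.ext_ghost fun m hm => by
    let w : BigLambda A →+ A := AddMonoidHom.mk' (fun f => ghost f.series m)
      fun f g => BigLambda.ghost_add f g hm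
    have hw : ∀ (i : ℕ) (f : BigLambda A), ghost (BigLambda.lamOp i f).series m =
        coeff i (ofGhost fun k => ghost f.series (m * k)) := fun i f => by
      rw [BigLambda.series_lamOp, ← (isGhost_ofGhost _).eq_ghost (constantCoeff_ofGhost _) hm]
    change _ = w _
    rw [map_sum, hw]
    have e : (ofGhost fun k => ghost (f + g).series (m * k)) =
        (ofGhost fun k => ghost f.series (m * k)) * ofGhost fun k => ghost g.series (m * k) := by
      refine ((((isGhost_ofGhost _).mul (isGhost_ofGhost _)).congr
        fun k hk => ?_).eq_ofGhost ?_).symm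
      · exact (BigLambda.ghost_add f g (Nat.mul_ne_zero hm hk)).symm
      · rw [map_mul, constantCoeff_ofGhost, constantCoeff_ofGhost, one_mul]
    rw [e, PowerSeries.coeff_mul]
    refine Finset.sum_congr rfl fun p _ => ?_
    change _ = ghost _ m
    rw [BigLambda.ghost_mul _ _ hm, hw, hw]

end LambdaSeries

open CategoryTheory MonoidalCategory

namespace TensorCat
universe v u w

section Power
variable {C : Type u} [Category.{v} C] [MonoidalCategory C]

/-- The tensor power `X ⊗ (X ⊗ (⋯ ⊗ (X ⊗ 𝟙)))` with `n` factors `X`. -/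
@[reducible] def tensorPow (X : C) : ℕ → C
  | 0 => 𝟙_ C
  | n + 1 => X ⊗ tensorPow X n

/-- The morphism `f ⊗ ⋯ ⊗ f` between tensor powers. -/
def tensorPowMap {X Y : C} (f : X ⟶ Y) : (n : ℕ) → (tensorPow X n ⟶ tensorPow Y n)
  | 0 => 𝟙 (𝟙_ C)
  | n + 1 => f ⊗ₘ tensorPowMap f n

lemma tensorPowMap_id (X : C) (n : ℕ) : tensorPowMap (𝟙 X) n = 𝟙 (tensorPow X n) := by
  induction n with
  | zero => rfl
  | succ n ih => simp [tensorPowMap, ih, tensorPow]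

lemma tensorPowMap_comp {X Y Z : C} (f : X ⟶ Y) (g : Y ⟶ Z) (n : ℕ) :
    tensorPowMap (f ≫ g) n = tensorPowMap f n ≫ tensorPowMap g n := by
  induction n with
  | zero => exact (Category.comp_id _).symm
  | succ n ih =>
    change (f ≫ g) ⊗ₘ tensorPowMap (f ≫ g) n =
      (f ⊗ₘ tensorPowMap f n) ≫ (g ⊗ₘ tensorPowMap g n)
    rw [ih, tensorHom_comp_tensorHom]

variable [SymmetricCategory C]

/-- The exchange of the first two factors, `X ⊗ (X ⊗ T) ⟶ X ⊗ (X ⊗ T)`. -/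
def swapHead (X T : C) : X ⊗ (X ⊗ T) ⟶ X ⊗ (X ⊗ T) :=
  (α_ X X T).inv ≫ (β_ X X).hom ▷ T ≫ (α_ X X T).hom

lemma swapHead_swapHead (X T : C) : swapHead X T ≫ swapHead X T = 𝟙 _ := by
  simp [swapHead, ← comp_whiskerRight_assoc]

lemma swapHead_naturality {X Y S T : C} (f : X ⟶ Y) (h : S ⟶ T) :
    (f ⊗ₘ (f ⊗ₘ h)) ≫ swapHead Y T = swapHead X S ≫ (f ⊗ₘ (f ⊗ₘ h)) := by
  simp only [swapHead, Category.assoc]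
  rw [associator_inv_naturality_assoc, ← tensorHom_id, tensorHom_comp_tensorHom_assoc,
    BraidedCategory.braiding_naturality, Category.comp_id, ← associator_naturality,
    ← tensorHom_id, tensorHom_comp_tensorHom_assoc, Category.id_comp]

lemma swapHead_tail (X : C) {S T : C} (h : S ⟶ T) :
    X ◁ X ◁ h ≫ swapHead X T = swapHead X S ≫ X ◁ X ◁ h := by
  simpa using swapHead_naturality (𝟙 X) h

lemma swapHead_braid (X T : C) :
    swapHead X (X ⊗ T) ≫ X ◁ swapHead X T ≫ swapHead X (X ⊗ T) =
      X ◁ swapHead X T ≫ swapHead X (X ⊗ T) ≫ X ◁ swapHead X T := by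
  have := BraidedCategory.yang_baxter' X X X
  have h2 := congrArg (fun k => (𝟙 _ ⊗≫ (k ▷ T) ⊗≫ 𝟙 _ : X ⊗ X ⊗ X ⊗ T ⟶ X ⊗ X ⊗ X ⊗ T)) this
  simp only [swapHead] at h2 ⊢
  convert h2 using 1 <;> monoidal

lemma swapHead_move (X T : C) (m : X ⊗ T ⟶ X ⊗ T) :
    (swapHead X (X ⊗ T) ≫ X ◁ (swapHead X T ≫ X ◁ m)) ≫ swapHead X (X ⊗ T) =
      X ◁ swapHead X T ≫ swapHead X (X ⊗ T) ≫ X ◁ (swapHead X T ≫ X ◁ m) := by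
  simp only [MonoidalCategory.whiskerLeft_comp, Category.assoc]
  rw [swapHead_tail, ← reassoc_of% (swapHead_braid X T)]

lemma swapHead_move_tail (X T : C) (c a : X ⊗ T ⟶ X ⊗ T) (b : T ⟶ T)
    (h : c ≫ a = X ◁ b ≫ c) :
    (swapHead X T ≫ X ◁ c) ≫ X ◁ a = X ◁ X ◁ b ≫ swapHead X T ≫ X ◁ c := by
  rw [Category.assoc, ← MonoidalCategory.whiskerLeft_comp, h,
    MonoidalCategory.whiskerLeft_comp, reassoc_of% (swapHead_tail X b)]

/-- The morphism moving the first of `n + 1` factors to position `k`, the factors that were at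
positions `1, …, k` each moving one step to the front. -/
def moveHead (X : C) : (n : ℕ) → Fin (n + 1) → (tensorPow X (n + 1) ⟶ tensorPow X (n + 1))
  | 0, _ => 𝟙 _
  | n + 1, k => Fin.cases (𝟙 _) (fun k' => swapHead X (tensorPow X n) ≫ X ◁ moveHead X n k') k

/-- Forget position `0` in the source of a permutation and its image in the target, and renumber. -/
def permTail {n : ℕ} (σ : Equiv.Perm (Fin (n + 1))) : Equiv.Perm (Fin n) :=
  Equiv.removeNone (((finSuccEquiv' 0).symm.trans σ).trans (finSuccEquiv' (σ 0)))

lemma succAbove_permTail {n : ℕ} (σ : Equiv.Perm (Fin (n + 1))) (i : Fin n) :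
    (σ 0).succAbove (permTail σ i) = σ i.succ := by
  have hne : σ i.succ ≠ σ 0 := fun h => (Fin.succ_ne_zero i) (σ.injective h)
  obtain ⟨j, hj⟩ := Fin.exists_succAbove_eq hne
  have h : some (permTail σ i) = some j := by
    unfold permTail
    rw [Equiv.removeNone_some] <;> simp [finSuccEquiv'_symm_some, ← hj]
  rw [Option.some_injective _ h, hj]

lemma permTail_unique {n : ℕ} (σ : Equiv.Perm (Fin (n + 1))) (τ : Equiv.Perm (Fin n))
    (h : ∀ i, (σ 0).succAbove (τ i) = σ i.succ) : permTail σ = τ := by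
  ext i : 1
  apply (σ 0).succAbove_right_injective
  rw [succAbove_permTail, h]

/-- The action of a permutation on a tensor power: the factor at position `i` is moved to position
`σ i` by the commutativity constraint. -/
def permMap (X : C) : (n : ℕ) → Equiv.Perm (Fin n) → (tensorPow X n ⟶ tensorPow X n)
  | 0, _ => 𝟙 _
  | n + 1, σ => X ◁ permMap X n (permTail σ) ≫ moveHead X n (σ 0)

/-- The exchange of the adjacent factors at positions `i` and `i + 1`. -/
def adjSwap (X : C) : (n : ℕ) → Fin n → (tensorPow X (n + 1) ⟶ tensorPow X (n + 1))
  | 0, i => i.elim0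
  | n + 1, i => Fin.cases (swapHead X (tensorPow X n)) (fun i' => X ◁ adjSwap X n i') i

lemma moveHead_zero (X : C) (n : ℕ) : moveHead X n 0 = 𝟙 _ := by
  cases n <;> rfl

lemma moveHead_succ (X : C) (n : ℕ) (k : Fin (n + 1)) :
    moveHead X (n + 1) k.succ = swapHead X (tensorPow X n) ≫ X ◁ moveHead X n k := rfl

lemma adjSwap_zero (X : C) (n : ℕ) : adjSwap X (n + 1) 0 = swapHead X (tensorPow X n) := rfl

lemma adjSwap_succ (X : C) (n : ℕ) (i : Fin n) :
    adjSwap X (n + 1) i.succ = X ◁ adjSwap X n i := rfl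

lemma adjSwap_adjSwap (X : C) (n : ℕ) (i : Fin n) : adjSwap X n i ≫ adjSwap X n i = 𝟙 _ := by
  induction n with
  | zero => exact i.elim0
  | succ n ih =>
    refine Fin.cases ?_ (fun i' => ?_) i
    · exact swapHead_swapHead _ _
    · rw [adjSwap_succ]
      erw [← whiskerLeft_comp, ih, whiskerLeft_id]

lemma moveHead_adjSwap (X : C) (n : ℕ) (i : Fin n) :
    moveHead X n i.castSucc ≫ adjSwap X n i = moveHead X n i.succ := by
  induction n with
  | zero => exact i.elim0
  | succ n ih =>
    refine Fin.cases ?_ (fun i' => ?_) i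
    · rw [Fin.castSucc_zero, moveHead_zero, Category.id_comp, moveHead_succ, moveHead_zero]
      erw [whiskerLeft_id, Category.comp_id]
      rfl
    · rw [Fin.castSucc_succ, moveHead_succ, moveHead_succ, adjSwap_succ, ← ih]
      erw [whiskerLeft_comp, Category.assoc]

lemma moveHead_adjSwap_comm (X : C) (n : ℕ) (k : Fin (n + 2)) (i : Fin (n + 1)) (j : Fin n)
    (h₁ : k.succAbove j.castSucc = i.castSucc) (h₂ : k.succAbove j.succ = i.succ) :
    moveHead X (n + 1) k ≫ adjSwap X (n + 1) i = X ◁ adjSwap X n j ≫ moveHead X (n + 1) k := by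
  induction n with
  | zero => exact j.elim0
  | succ n ih =>
    obtain rfl | ⟨k, rfl⟩ := Fin.eq_zero_or_eq_succ k
    · obtain rfl : i = j.succ := by
        apply Fin.succ_injective
        rw [← h₂, Fin.succAbove_zero]
      rw [moveHead_zero, adjSwap_succ]
      exact (Category.id_comp _).trans (Category.comp_id _).symm
    obtain rfl | ⟨i, rfl⟩ := Fin.eq_zero_or_eq_succ i
    · obtain rfl | ⟨j, rfl⟩ := Fin.eq_zero_or_eq_succ j
      · obtain rfl | ⟨k, rfl⟩ := Fin.eq_zero_or_eq_succ k
        · rw [Fin.succ_succAbove_succ, Fin.zero_succAbove] at h₂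
          exact absurd (Fin.succ_injective _ h₂) (Fin.succ_ne_zero _)
        · rw [moveHead_succ, adjSwap_zero, adjSwap_zero, moveHead_succ]
          exact swapHead_move X (tensorPow X n) (moveHead X n k)
      · exfalso
        rw [Fin.castSucc_succ, Fin.succ_succAbove_succ] at h₁
        exact Fin.succ_ne_zero _ h₁
    · obtain rfl | ⟨j, rfl⟩ := Fin.eq_zero_or_eq_succ j
      · exfalso
        rw [Fin.castSucc_zero, Fin.succ_succAbove_zero, Fin.castSucc_succ] at h₁
        exact (Fin.succ_ne_zero _ h₁.symm)
      · have e := ih k i j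
          (Fin.succ_injective _ (by
            rw [← Fin.succ_succAbove_succ, ← Fin.castSucc_succ, h₁, Fin.castSucc_succ]))
          (Fin.succ_injective _ (by rw [← Fin.succ_succAbove_succ, h₂]))
        rw [moveHead_succ, adjSwap_succ, adjSwap_succ]
        exact swapHead_move_tail X _ _ _ _ e

lemma permTail_swap_left {n : ℕ} (σ : Equiv.Perm (Fin (n + 1))) (i : Fin n)
    (h : σ 0 = i.castSucc ∨ σ 0 = i.succ) :
    permTail (Equiv.swap i.castSucc i.succ * σ) = permTail σ := by
  apply permTail_unique
  intro a
  simp only [Equiv.Perm.mul_apply, ← succAbove_permTail σ a]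
  rcases h with h | h <;> rw [h] <;>
    (generalize permTail σ a = b)
  all_goals
    simp only [Equiv.swap_apply_left, Equiv.swap_apply_right, Fin.succAbove,
      Equiv.swap_apply_def, Fin.ext_iff, Fin.lt_def] <;>
    split_ifs <;> simp_all [Fin.ext_iff] <;> omega

/-- An adjacent transposition that does not involve position `k` comes from an adjacent
transposition of the remaining positions. -/
lemma exists_adjacent {n : ℕ} (k : Fin (n + 2)) (i : Fin (n + 1)) (h₁ : k ≠ i.castSucc)
    (h₂ : k ≠ i.succ) :
    ∃ j : Fin n, k.succAbove j.castSucc = i.castSucc ∧ k.succAbove j.succ = i.succ := by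
  rw [ne_eq, Fin.ext_iff, Fin.val_castSucc] at h₁
  rw [ne_eq, Fin.ext_iff, Fin.val_succ] at h₂
  by_cases h : (k : ℕ) < i
  · refine ⟨⟨i - 1, by omega⟩, ?_, ?_⟩ <;>
    · simp only [Fin.succAbove, Fin.ext_iff, Fin.lt_def]
      split_ifs <;> simp_all <;> omega
  · refine ⟨⟨i, by omega⟩, ?_, ?_⟩ <;>
    · simp only [Fin.succAbove, Fin.ext_iff, Fin.lt_def]
      split_ifs <;> simp_all <;> omega

lemma permMap_swap_mul (X : C) (n : ℕ) (i : Fin n) (σ : Equiv.Perm (Fin (n + 1))) :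
    permMap X (n + 1) (Equiv.swap i.castSucc i.succ * σ) =
      permMap X (n + 1) σ ≫ adjSwap X n i := by
  induction n with
  | zero => exact i.elim0
  | succ n ih =>
    change X ◁ permMap X (n + 1) _ ≫ moveHead X (n + 1) (Equiv.swap i.castSucc i.succ (σ 0)) =
      (X ◁ permMap X (n + 1) _ ≫ moveHead X (n + 1) _) ≫ adjSwap X (n + 1) i
    by_cases h₁ : σ 0 = i.castSucc
    · rw [permTail_swap_left σ i (Or.inl h₁), h₁, Equiv.swap_apply_left, Category.assoc]
      exact congrArg _ (moveHead_adjSwap X (n + 1) i).symm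
    by_cases h₂ : σ 0 = i.succ
    · rw [permTail_swap_left σ i (Or.inr h₂), h₂, Equiv.swap_apply_right, Category.assoc]
      refine congrArg _ ?_
      rw [← moveHead_adjSwap]
      exact ((congrArg _ (adjSwap_adjSwap X (n + 1) i)).trans (Category.comp_id _)).symm.trans
        (Category.assoc _ _ _).symm
    obtain ⟨j, hj₁, hj₂⟩ := exists_adjacent (σ 0) i h₁ h₂
    have ht : permTail (Equiv.swap i.castSucc i.succ * σ) =
        Equiv.swap j.castSucc j.succ * permTail σ := by
      apply permTail_unique
      intro a
      simp only [Equiv.Perm.mul_apply, ← succAbove_permTail σ a]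
      rw [Equiv.swap_apply_of_ne_of_ne h₁ h₂, ← hj₁, ← hj₂,
        ((σ 0).succAbove_right_injective).swap_apply]
    rw [ht, ih, Equiv.swap_apply_of_ne_of_ne h₁ h₂, Category.assoc]
    refine Eq.trans ?_ (congrArg _ (moveHead_adjSwap_comm X n (σ 0) i j hj₁ hj₂).symm)
    exact (congrArg (· ≫ moveHead X (n + 1) (σ 0))
      (MonoidalCategory.whiskerLeft_comp X _ _)).trans (Category.assoc _ _ _)

lemma permTail_one (n : ℕ) : permTail (1 : Equiv.Perm (Fin (n + 1))) = 1 :=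
  permTail_unique _ _ (fun i => by simp)

lemma permMap_one (X : C) (n : ℕ) : permMap X n 1 = 𝟙 _ := by
  induction n with
  | zero => rfl
  | succ n ih =>
    change X ◁ permMap X n (permTail 1) ≫ moveHead X n 0 = 𝟙 (X ⊗ tensorPow X n)
    rw [permTail_one, ih, moveHead_zero, MonoidalCategory.whiskerLeft_id]
    exact Category.comp_id _

lemma permMap_mul (X : C) (n : ℕ) (τ σ : Equiv.Perm (Fin n)) :
    permMap X n (τ * σ) = permMap X n σ ≫ permMap X n τ := by
  cases n with
  | zero => exact (Category.comp_id _).symm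
  | succ n =>
    have hτ : τ ∈ Submonoid.closure
        (Set.range fun i : Fin n => Equiv.swap i.castSucc i.succ) := by
      rw [Equiv.Perm.mclosure_swap_castSucc_succ]; trivial
    induction hτ using Submonoid.closure_induction generalizing σ with
    | mem x hx =>
      obtain ⟨i, rfl⟩ := hx
      have h := permMap_swap_mul X n i 1
      rw [mul_one, permMap_one, Category.id_comp] at h
      rw [permMap_swap_mul, h]
    | one => rw [one_mul, permMap_one, Category.comp_id]
    | mul x y _ _ hx hy => rw [mul_assoc, hx, hy, hx y, Category.assoc]

lemma moveHead_naturality {X Y : C} (f : X ⟶ Y) (n : ℕ) (k : Fin (n + 1)) :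
    tensorPowMap f (n + 1) ≫ moveHead Y n k = moveHead X n k ≫ tensorPowMap f (n + 1) := by
  induction n with
  | zero => exact (Category.comp_id _).trans (Category.id_comp _).symm
  | succ n ih =>
    obtain rfl | ⟨k, rfl⟩ := Fin.eq_zero_or_eq_succ k
    · rw [moveHead_zero, moveHead_zero]
      exact (Category.comp_id _).trans (Category.id_comp _).symm
    · rw [moveHead_succ, moveHead_succ]
      change (f ⊗ₘ (f ⊗ₘ tensorPowMap f n)) ≫ swapHead Y _ ≫ Y ◁ moveHead Y n k =
        (swapHead X _ ≫ X ◁ moveHead X n k) ≫ (f ⊗ₘ tensorPowMap f (n + 1))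
      rw [reassoc_of% (swapHead_naturality f (tensorPowMap f n)), Category.assoc]
      refine congrArg _ ?_
      have h : tensorPowMap f (n + 1) ≫ moveHead Y n k =
        moveHead X n k ≫ tensorPowMap f (n + 1) := ih k
      calc _ = f ⊗ₘ (tensorPowMap f (n + 1) ≫ moveHead Y n k) := by
            rw [← id_tensorHom]
            exact (tensorHom_comp_tensorHom _ _ _ _).trans (by rw [Category.comp_id]; rfl)
        _ = _ := by
            rw [h, ← id_tensorHom]
            exact ((tensorHom_comp_tensorHom _ _ _ _).trans (by rw [Category.id_comp])).symm

lemma permMap_naturality {X Y : C} (f : X ⟶ Y) (n : ℕ) (σ : Equiv.Perm (Fin n)) :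
    tensorPowMap f n ≫ permMap Y n σ = permMap X n σ ≫ tensorPowMap f n := by
  induction n with
  | zero => rfl
  | succ n ih =>
    have h := moveHead_naturality f n (σ 0)
    change (f ⊗ₘ tensorPowMap f n) ≫ Y ◁ permMap Y n _ ≫ moveHead Y n _ =
      (X ◁ permMap X n _ ≫ moveHead X n _) ≫ tensorPowMap f (n + 1)
    rw [Category.assoc]
    refine Eq.trans ?_ (congrArg _ h)
    change _ = X ◁ permMap X n _ ≫ (f ⊗ₘ tensorPowMap f n) ≫ moveHead Y n _
    rw [← id_tensorHom, ← id_tensorHom, tensorHom_comp_tensorHom_assoc,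
      tensorHom_comp_tensorHom_assoc, ih, Category.comp_id, Category.id_comp]

end Power

section Exterior
variable {C : Type u} [Category.{v} C] [Preadditive C] [Linear ℚ C] [MonoidalCategory C]
  [SymmetricCategory C]

open scoped Nat in
/-- The antisymmetrizer `(1 / n!) ∑ sgn(σ) σ` on the `n`-th tensor power of `X`. -/
noncomputable def antisymmetrizer (X : C) (n : ℕ) : tensorPow X n ⟶ tensorPow X n :=
  ((n ! : ℚ)⁻¹) • ∑ σ : Equiv.Perm (Fin n), ((Equiv.Perm.sign σ : ℤ) : ℚ) • permMap X n σ

lemma permMap_antisymmetrizer (X : C) (n : ℕ) (τ : Equiv.Perm (Fin n)) :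
    permMap X n τ ≫ antisymmetrizer X n =
      ((Equiv.Perm.sign τ : ℤ) : ℚ) • antisymmetrizer X n := by
  rw [antisymmetrizer, Linear.comp_smul, smul_comm, Preadditive.comp_sum,
    Finset.smul_sum (r := ((Equiv.Perm.sign τ : ℤ) : ℚ))]
  refine congrArg _ (Fintype.sum_equiv (Equiv.mulRight τ) _ _ fun σ => ?_)
  rw [Linear.comp_smul, ← permMap_mul, Equiv.coe_mulRight, smul_smul, Equiv.Perm.sign_mul]
  congr 1
  rcases Int.units_eq_one_or (Equiv.Perm.sign τ) with h | h <;> simp [h]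

lemma antisymmetrizer_idem (X : C) (n : ℕ) :
    antisymmetrizer X n ≫ antisymmetrizer X n = antisymmetrizer X n := by
  conv_lhs => enter [1]; rw [antisymmetrizer]
  have h : ∀ σ : Equiv.Perm (Fin n),
      (((Equiv.Perm.sign σ : ℤ) : ℚ) • permMap X n σ) ≫ antisymmetrizer X n =
        antisymmetrizer X n := by
    intro σ
    rw [Linear.smul_comp, permMap_antisymmetrizer, smul_smul]
    rcases Int.units_eq_one_or (Equiv.Perm.sign σ) with h | h <;> simp [h]
  rw [Linear.smul_comp, Preadditive.sum_comp, Finset.sum_congr rfl fun σ _ => h σ,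
    Finset.sum_const, Finset.card_univ, Fintype.card_perm, Fintype.card_fin,
    ← Nat.cast_smul_eq_nsmul ℚ, smul_smul, inv_mul_cancel₀ (by positivity), one_smul]

lemma antisymmetrizer_naturality {X Y : C} (f : X ⟶ Y) (n : ℕ) :
    tensorPowMap f n ≫ antisymmetrizer Y n = antisymmetrizer X n ≫ tensorPowMap f n := by
  simp only [antisymmetrizer, Linear.comp_smul, Linear.smul_comp, Preadditive.comp_sum,
    Preadditive.sum_comp, permMap_naturality]

variable [IsIdempotentComplete C]

/-- The exterior power `Λⁿ X`: the image of the antisymmetrizer. -/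
noncomputable def extPow (n : ℕ) (X : C) : C :=
  (IsIdempotentComplete.idempotents_split _ _ (antisymmetrizer_idem X n)).choose

/-- The inclusion of `Λⁿ X` in the tensor power. -/
noncomputable def extPowIncl (n : ℕ) (X : C) : extPow n X ⟶ tensorPow X n :=
  (IsIdempotentComplete.idempotents_split _ _ (antisymmetrizer_idem X n)).choose_spec.choose

/-- The projection of the tensor power onto `Λⁿ X`. -/
noncomputable def extPowProj (n : ℕ) (X : C) : tensorPow X n ⟶ extPow n X :=
  (IsIdempotentComplete.idempotents_split _ _
    (antisymmetrizer_idem X n)).choose_spec.choose_spec.choose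

lemma extPowIncl_proj (n : ℕ) (X : C) : extPowIncl n X ≫ extPowProj n X = 𝟙 _ :=
  (IsIdempotentComplete.idempotents_split _ _
    (antisymmetrizer_idem X n)).choose_spec.choose_spec.choose_spec.1

lemma extPowProj_incl (n : ℕ) (X : C) : extPowProj n X ≫ extPowIncl n X = antisymmetrizer X n :=
  (IsIdempotentComplete.idempotents_split _ _
    (antisymmetrizer_idem X n)).choose_spec.choose_spec.choose_spec.2

variable (C) in
/-- The exterior power functor `Λⁿ`; on morphisms it is the restriction of `f ⊗ ⋯ ⊗ f`. -/
noncomputable def extPowFunctor (n : ℕ) : C ⥤ C where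
  obj X := extPow n X
  map {X Y} f := extPowIncl n X ≫ tensorPowMap f n ≫ extPowProj n Y
  map_id X := by rw [tensorPowMap_id, Category.id_comp, extPowIncl_proj]
  map_comp {X Y Z} f g := by
    have h : extPowIncl n X ≫ antisymmetrizer X n = extPowIncl n X := by
      rw [← extPowProj_incl, reassoc_of% (extPowIncl_proj n X)]
    simp only [Category.assoc]
    rw [reassoc_of% (extPowProj_incl n Y), reassoc_of% (antisymmetrizer_naturality f n),
      reassoc_of% h, tensorPowMap_comp, Category.assoc]

end Exterior

section Trace
variable {C : Type u} [Category.{v} C] [MonoidalCategory C] [SymmetricCategory C]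

/-- The trace of `f : X ⟶ X` in `End 𝟙`: the composite `𝟙 ⟶ X ⊗ Xᘁ ⟶ X ⊗ Xᘁ ≅ Xᘁ ⊗ X ⟶ 𝟙`. -/
def tr (X : C) [HasRightDual X] (f : X ⟶ X) : End (𝟙_ C) :=
  η_ X Xᘁ ≫ f ▷ Xᘁ ≫ (β_ X Xᘁ).hom ≫ ε_ X Xᘁ

lemma tr_comp_comm {X Y : C} [HasRightDual X] [HasRightDual Y] (f : X ⟶ Y) (g : Y ⟶ X) :
    tr X (f ≫ g) = tr Y (g ≫ f) := by
  simp only [tr, comp_whiskerRight, Category.assoc]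
  rw [← coevaluation_comp_rightAdjointMate_assoc, whisker_exchange_assoc,
    BraidedCategory.braiding_naturality_right_assoc, rightAdjointMate_comp_evaluation,
    ← BraidedCategory.braiding_naturality_left_assoc]

lemma tr_unit_id [h : HasRightDual (𝟙_ C)] : tr (𝟙_ C) (𝟙 (𝟙_ C)) = 𝟙 (𝟙_ C) := by
  have e := @tr_comp_comm C _ _ _ (𝟙_ C) (𝟙_ C) h hasRightDualUnit (𝟙 _) (𝟙 _)
  rw [Category.comp_id] at e
  refine e.trans ?_
  have e₁ : @ExactPairing.coevaluation C _ _ (𝟙_ C) (𝟙_ C) exactPairingUnit = (ρ_ _).inv := rfl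
  have e₂ : @ExactPairing.evaluation C _ _ (𝟙_ C) (𝟙_ C) exactPairingUnit = (ρ_ _).hom := rfl
  simp only [tr, id_whiskerRight, Category.id_comp]
  change @ExactPairing.coevaluation C _ _ (𝟙_ C) (𝟙_ C) exactPairingUnit ≫ (β_ (𝟙_ C) (𝟙_ C)).hom ≫
    @ExactPairing.evaluation C _ _ (𝟙_ C) (𝟙_ C) exactPairingUnit = _
  rw [e₁, e₂]
  simp [unitors_inv_equal]

end Trace

section EndUnit
variable {C : Type u} [Category.{v} C] [MonoidalCategory C]

lemma endUnit_comp_comm (f g : 𝟙_ C ⟶ 𝟙_ C) : f ≫ g = g ≫ f := by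
  have h := whisker_exchange f g
  have e₁ : f ▷ 𝟙_ C = (ρ_ _).hom ≫ f ≫ (ρ_ _).inv := by simp
  have e₂ : 𝟙_ C ◁ g = (ρ_ _).hom ≫ g ≫ (ρ_ _).inv := by
    simp [← unitors_equal, ← unitors_inv_equal]
  rw [e₁, e₂] at h
  simpa using h.symm

/-- The endomorphisms of the unit object form a commutative ring. -/
instance [Preadditive C] : CommRing (End (𝟙_ C)) where
  mul_comm f g := endUnit_comp_comm g f

end EndUnit

section Character
variable {C : Type u} [Category.{v} C] [Preadditive C] [Linear ℚ C] [MonoidalCategory C]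
  [SymmetricCategory C] [IsIdempotentComplete C] [RightRigidCategory C]
  {G : Type w} [Monoid G]

/-- The exterior power `Λⁿ X` of a representation `X`, on which `g` acts by `Λⁿ(g)`. -/
noncomputable def extPowRep (n : ℕ) (X : Action C G) : Action C G :=
  ((extPowFunctor C n).mapAction G).obj X

/-- The trace `tr(g; X)` of the action of `g` on a representation `X`. -/
def trRep (X : Action C G) (g : G) : End (𝟙_ C) := tr X.V (X.ρ g)

lemma trRep_extPowRep_zero (X : Action C G) (g : G) : trRep (extPowRep 0 X) g = 1 := by
  change tr (extPow 0 X.V) (extPowIncl 0 X.V ≫ 𝟙 (𝟙_ C) ≫ extPowProj 0 X.V) = 𝟙 (𝟙_ C)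
  rw [Category.id_comp, tr_comp_comm, extPowProj_incl]
  have : antisymmetrizer X.V 0 = 𝟙 (𝟙_ C) := by simp [antisymmetrizer, permMap]
  rw [this, tr_unit_id]

/-- The characteristic series `∑ tr(g; Λⁿ X) tⁿ`, an element of `Λ(End 𝟙)`. -/
noncomputable def charSeries (X : Action C G) (g : G) :
    LambdaSeries.BigLambda (End (𝟙_ C)) where
  series := PowerSeries.mk fun n => trRep (extPowRep n X) g
  constantCoeff_series := by
    rw [← PowerSeries.coeff_zero_eq_constantCoeff_apply, PowerSeries.coeff_mk,
      trRep_extPowRep_zero]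

end Character
end TensorCat

/-! Everything is read off from power sums (`ghost`). Over a `ℚ`-algebra an element of `Λ(A)` is
determined by its power sums `w_m` with `m ≥ 1`, so two facts suffice: `w_m(ψ_n x) = w_{mn}(x)`, and
`w_m` of the characteristic series of `g` is `tr(g^m; X)`. The first identity of the theorem then
says that `(g^n)^m = g^{mn}`, and the second is the definition of the power sums.

The first fact (`ghost_adams`) holds because each `w_m` is a ring homomorphism `Λ(A) → A` and
carries the series of the `λ^j x` to the series over `A` whose power sums are `w_m(x), w_{2m}(x),
…`; a ring homomorphism commutes with taking logarithmic derivatives.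

The second fact amounts to Newton's relations between `e_n = tr(f; Λⁿ X)` and `tr(f^n)`, for an
endomorphism `f` of a dualizable object (`extTrace_newton`). Eigenvalues are not available, so the
relations come from a recursion on traces. Write `A_n` for the antisymmetrizer and let `H_n(h)` be
the trace of `A_{n+1}` composed with `h ⊗ f ⊗ ⋯ ⊗ f`, with `n` factors `f`. Sorting permutations by
the image of position `0` expresses `A_{n+2}` through `1 ⊗ A_{n+1}` (`antisymmetrizer_succ`).
Permutations fixing `0` contribute `e_{n+1} tr(h)`. In every other coset the strand carrying `h` is
closed up through the swap of the first two factors (`tr_whiskerLeft_comp_swapHead`), which merges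
`h` with one `f` and leaves `-H_n(hf)`. Hence `(n+2) H_{n+1}(h) = e_{n+1} tr(h) - (n+1) H_n(hf)`
(`hookTrace_succ`). Iterating from `h = f`, where `H_n(f) = e_{n+1}`, gives Newton's relations. -/

namespace TensorCat
universe v u w

/-! ### Traces of tensor products by partial traces -/

section PartialTrace
variable {C : Type u} [Category.{v} C] [MonoidalCategory C] [SymmetricCategory C]

/-- Cyclicity applied to `f` and the identity, with the two copies of `X` carrying different duals.
This allows computing with whichever dual is convenient. -/
lemma tr_eq_of_hasRightDual (X : C) (h₁ h₂ : HasRightDual X) (f : X ⟶ X) :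
    @tr C _ _ _ X h₁ f = @tr C _ _ _ X h₂ f := by
  have e := @tr_comp_comm C _ _ _ X X h₁ h₂ f (𝟙 X)
  rwa [Category.comp_id, Category.id_comp] at e

lemma tr_conj {X Y : C} [HasRightDual X] [HasRightDual Y] (i : X ≅ Y) (f : Y ⟶ Y) :
    tr X (i.hom ≫ f ≫ i.inv) = tr Y f := by
  rw [tr_comp_comm, Category.assoc, i.inv_hom_id, Category.comp_id]

/-- The evaluation of an exact pairing, with the object and its dual exchanged. -/
def braidedEv (X D : C) [ExactPairing X D] : X ⊗ D ⟶ 𝟙_ C := (β_ X D).hom ≫ ε_ X D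

/-- The strand `E` slides past the cap joining `X` and `D`: naturality of the braiding moves it
across all of `X ⊗ D`, and symmetry turns the crossing with `X` alone into one with `D` alone. -/
lemma braiding_comp_whiskerLeft_braidedEv (X D E : C) [ExactPairing X D] :
    (β_ X E).hom ▷ D ⊗≫ E ◁ braidedEv X D =
      𝟙 _ ⊗≫ X ◁ (β_ E D).hom ⊗≫ braidedEv X D ▷ E ⊗≫ 𝟙 _ := by
  have h := BraidedCategory.braiding_naturality_left (braidedEv X D) E
  rw [BraidedCategory.braiding_tensor_left_hom] at h
  have h₂ : (β_ (𝟙_ C) E).hom = 𝟙 _ ⊗≫ 𝟙 _ := by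
    rw [braiding_tensorUnit_left]; simp [monoidalComp]
  calc _ = 𝟙 _ ⊗≫ X ◁ ((β_ E D).hom ≫ (β_ D E).hom) ⊗≫ (β_ X E).hom ▷ D ⊗≫
        E ◁ braidedEv X D := by
        rw [SymmetricCategory.symmetry]; monoidal
    _ = 𝟙 _ ⊗≫ X ◁ (β_ E D).hom ⊗≫ (((α_ X D E).hom ≫ X ◁ (β_ D E).hom ≫ (α_ X E D).inv ≫
          (β_ X E).hom ▷ D ≫ (α_ E X D).hom) ≫ E ◁ braidedEv X D) := by monoidal
    _ = 𝟙 _ ⊗≫ X ◁ (β_ E D).hom ⊗≫ (braidedEv X D ▷ E ≫ (β_ (𝟙_ C) E).hom) := by rw [h]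
    _ = _ := by rw [h₂]; monoidal

/-- The cap of a tensor product consists of two nested caps, the one for `S` inside the one for `X`.
The hexagon identities produce the extra crossings, and sliding strands past caps removes them. -/
lemma braidedEv_tensor (X S D E : C) [ExactPairing X D] [ExactPairing S E] :
    braidedEv (X ⊗ S) (E ⊗ D) =
      𝟙 _ ⊗≫ X ◁ braidedEv S E ▷ D ⊗≫ braidedEv X D := by
  have h₂ : (β_ (𝟙_ C) D).hom = 𝟙 _ ⊗≫ 𝟙 _ := by
    rw [braiding_tensorUnit_left]; simp [monoidalComp]
  have h₃ := BraidedCategory.braiding_naturality_left (ε_ S E) D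
  rw [BraidedCategory.braiding_tensor_left_hom] at h₃
  calc _ = 𝟙 _ ⊗≫ X ◁ (β_ S E).hom ▷ D ⊗≫ X ◁ E ◁ (β_ S D).hom ⊗≫
        ((β_ X E).hom ▷ D ⊗≫ E ◁ braidedEv X D) ▷ S ⊗≫ ε_ S E := by
        simp only [braidedEv]
        rw [BraidedCategory.braiding_tensor_left_hom, BraidedCategory.braiding_tensor_right_hom,
          BraidedCategory.braiding_tensor_right_hom, ExactPairing.tensor_evaluation]
        monoidal
    _ = 𝟙 _ ⊗≫ X ◁ (β_ S E).hom ▷ D ⊗≫ X ◁ E ◁ (β_ S D).hom ⊗≫ X ◁ (β_ E D).hom ▷ S ⊗≫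
        (braidedEv X D ▷ (E ⊗ S) ≫ 𝟙_ C ◁ ε_ S E) ⊗≫ 𝟙 _ := by
        rw [braiding_comp_whiskerLeft_braidedEv]; monoidal
    _ = 𝟙 _ ⊗≫ X ◁ (β_ S E).hom ▷ D ⊗≫ X ◁ (((α_ E S D).hom ≫ E ◁ (β_ S D).hom ≫
        (α_ E D S).inv ≫ (β_ E D).hom ▷ S ≫ (α_ D E S).hom) ≫ D ◁ ε_ S E) ⊗≫
        braidedEv X D ⊗≫ 𝟙 _ := by
        rw [← whisker_exchange]; monoidal
    _ = _ := by
        rw [← h₃, h₂]; simp only [braidedEv]; monoidal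

/-- The partial trace over the last factor. -/
def partialTrace {X Y S : C} [HasRightDual S] (h : X ⊗ S ⟶ Y ⊗ S) : X ⟶ Y :=
  𝟙 _ ⊗≫ X ◁ η_ S Sᘁ ⊗≫ h ▷ Sᘁ ⊗≫ Y ◁ braidedEv S Sᘁ ⊗≫ 𝟙 _

/-- For the dual `Sᘁ ⊗ Xᘁ` both the cup and the cap of `X ⊗ S` are nested, so closing the inner `S`
loop first is the partial trace. -/
lemma tr_tensor {X S : C} [HasRightDual X] [HasRightDual S] [h₀ : HasRightDual (X ⊗ S)]
    (h : X ⊗ S ⟶ X ⊗ S) : tr (X ⊗ S) h = tr X (partialTrace h) := by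
  rw [tr_eq_of_hasRightDual _ h₀ hasRightDualTensor]
  change η_ (X ⊗ S) (Sᘁ ⊗ Xᘁ) ≫ h ▷ (Sᘁ ⊗ Xᘁ) ≫ braidedEv (X ⊗ S) (Sᘁ ⊗ Xᘁ) =
    η_ X Xᘁ ≫ partialTrace h ▷ Xᘁ ≫ braidedEv X Xᘁ
  rw [braidedEv_tensor, ExactPairing.tensor_coevaluation, partialTrace]
  monoidal

lemma partialTrace_comp_whiskerRight {X Y Z S : C} [HasRightDual S] (h : X ⊗ S ⟶ Y ⊗ S)
    (f : Y ⟶ Z) : partialTrace (h ≫ f ▷ S) = partialTrace h ≫ f := by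
  calc _ = 𝟙 _ ⊗≫ X ◁ η_ S Sᘁ ⊗≫ h ▷ Sᘁ ⊗≫ (f ▷ (S ⊗ Sᘁ) ≫ Z ◁ braidedEv S Sᘁ) ⊗≫ 𝟙 _ := by
        rw [partialTrace]; monoidal
    _ = _ := by rw [← whisker_exchange, partialTrace]; monoidal

lemma partialTrace_whiskerLeft {X Y S : C} (Z : C) [HasRightDual S] (h : X ⊗ S ⟶ Y ⊗ S) :
    partialTrace ((α_ Z X S).hom ≫ Z ◁ h ≫ (α_ Z Y S).inv) = Z ◁ partialTrace h := by
  simp only [partialTrace]; monoidal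

/-- Closing one strand of a crossing leaves a kink. The two braidings combine into `X` crossing `X ⊗
Xᘁ`, naturality at the coevaluation removes that crossing, and a zigzag identity straightens the
rest. -/
lemma partialTrace_braiding (X : C) [HasRightDual X] : partialTrace (β_ X X).hom = 𝟙 X := by
  have h := BraidedCategory.braiding_naturality_right X (η_ X Xᘁ)
  rw [BraidedCategory.braiding_tensor_right_hom] at h
  have h₂ : (β_ X (𝟙_ C)).hom = 𝟙 _ ⊗≫ 𝟙 _ := by
    rw [braiding_tensorUnit_right]; simp [monoidalComp]
  calc _ = 𝟙 _ ⊗≫ (X ◁ η_ X Xᘁ ≫ (α_ X X Xᘁ).inv ≫ (β_ X X).hom ▷ Xᘁ ≫ (α_ X X Xᘁ).hom ≫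
        X ◁ (β_ X Xᘁ).hom ≫ (α_ X Xᘁ X).inv) ⊗≫ X ◁ ε_ X Xᘁ ⊗≫ 𝟙 _ := by
        simp only [partialTrace, braidedEv]; monoidal
    _ = 𝟙 _ ⊗≫ (η_ X Xᘁ ▷ X ⊗≫ X ◁ ε_ X Xᘁ) ⊗≫ 𝟙 _ := by
        rw [h, h₂]; monoidal
    _ = _ := by rw [ExactPairing.evaluation_coevaluation'']; monoidal

lemma partialTrace_whiskerLeft_end {X S : C} [HasRightDual S] (u : S ⟶ S) :
    partialTrace (X ◁ u) = (ρ_ X).inv ≫ X ◁ (tr S u : 𝟙_ C ⟶ 𝟙_ C) ≫ (ρ_ X).hom := by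
  change _ = (ρ_ X).inv ≫ X ◁ (η_ S Sᘁ ≫ u ▷ Sᘁ ≫ braidedEv S Sᘁ) ≫ (ρ_ X).hom
  simp only [partialTrace]; monoidal

/-- A scalar placed to the right of `X` equals the same scalar placed to its left, by naturality of
the braiding with the unit; from the left it slides out past the coevaluation. -/
lemma tr_scalar_comp {X : C} [HasRightDual X] (s : 𝟙_ C ⟶ 𝟙_ C) (f : X ⟶ X) :
    tr X (((ρ_ X).inv ≫ X ◁ s ≫ (ρ_ X).hom) ≫ f) = s ≫ (tr X f : 𝟙_ C ⟶ 𝟙_ C) := by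
  have h := BraidedCategory.braiding_naturality_right X s
  have h₁ : (ρ_ X).inv ≫ X ◁ s ≫ (ρ_ X).hom = (λ_ X).inv ≫ s ▷ X ≫ (λ_ X).hom := by
    rw [braiding_tensorUnit_right, Category.assoc] at h
    rw [← cancel_mono (λ_ X).inv]
    simp [h]
  rw [h₁]
  change η_ X Xᘁ ≫ _ ▷ Xᘁ ≫ braidedEv X Xᘁ = s ≫ η_ X Xᘁ ≫ f ▷ Xᘁ ≫ braidedEv X Xᘁ
  calc _ = 𝟙 _ ⊗≫ (𝟙_ C ◁ η_ X Xᘁ ≫ s ▷ (X ⊗ Xᘁ)) ⊗≫ f ▷ Xᘁ ≫ braidedEv X Xᘁ := by monoidal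
    _ = _ := by rw [whisker_exchange]; monoidal

lemma tr_tensorHom {X S : C} [HasRightDual X] [HasRightDual S] [HasRightDual (X ⊗ S)]
    (f : X ⟶ X) (u : S ⟶ S) :
    tr (X ⊗ S) (f ⊗ₘ u) = (tr S u : 𝟙_ C ⟶ 𝟙_ C) ≫ (tr X f : 𝟙_ C ⟶ 𝟙_ C) := by
  rw [tr_tensor, tensorHom_def', partialTrace_comp_whiskerRight, partialTrace_whiskerLeft_end,
    tr_scalar_comp]

lemma tr_whiskerLeft_comp_braiding {X : C} [HasRightDual X] [HasRightDual (X ⊗ X)]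
    (w : X ⟶ X) : tr (X ⊗ X) (X ◁ w ≫ (β_ X X).hom) = tr X w := by
  rw [BraidedCategory.braiding_naturality_right, tr_tensor, partialTrace_comp_whiskerRight,
    partialTrace_braiding, Category.id_comp]

/-- The swap is trivial on `T`, so the partial trace over `T` acts on `u` alone. What remains is an
endomorphism of the second factor of `X ⊗ X` followed by the braiding, and closing the braiding
fuses the two loops into one. -/
lemma tr_whiskerLeft_comp_swapHead {X T : C} [HasRightDual X] [HasRightDual T]
    [HasRightDual (X ⊗ T)] [HasRightDual (X ⊗ (X ⊗ T))] (u : X ⊗ T ⟶ X ⊗ T) :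
    tr (X ⊗ (X ⊗ T)) (X ◁ u ≫ swapHead X T) = tr (X ⊗ T) u := by
  let _ : HasRightDual (X ⊗ X) := hasRightDualTensor
  let _ : HasRightDual ((X ⊗ X) ⊗ T) := hasRightDualTensor
  have e : (α_ X X T).hom ≫ (X ◁ u ≫ swapHead X T) ≫ (α_ X X T).inv =
      ((α_ X X T).hom ≫ X ◁ u ≫ (α_ X X T).inv) ≫ (β_ X X).hom ▷ T := by
    simp [swapHead]
  rw [← tr_conj (α_ X X T), e, tr_tensor, partialTrace_comp_whiskerRight,
    partialTrace_whiskerLeft, tr_whiskerLeft_comp_braiding, ← tr_tensor]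

end PartialTrace

/-! ### Linearity of the trace -/

section LinearTrace
variable {C : Type u} [Category.{v} C] [Preadditive C] [MonoidalCategory C]
  [SymmetricCategory C] [MonoidalPreadditive C]

/-- The trace as an additive map. -/
def trAddHom (X : C) [HasRightDual X] : (X ⟶ X) →+ End (𝟙_ C) :=
  AddMonoidHom.mk' (tr X) fun f g => by
    simp only [tr, MonoidalPreadditive.add_whiskerRight, Preadditive.add_comp, Preadditive.comp_add]

lemma tr_sum (X : C) [HasRightDual X] {ι : Type*} (s : Finset ι) (f : ι → (X ⟶ X)) :
    tr X (∑ i ∈ s, f i) = ∑ i ∈ s, tr X (f i) :=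
  map_sum (trAddHom X) f s

variable [Linear ℚ C] [MonoidalLinear ℚ C]

lemma tr_smul (X : C) [HasRightDual X] (a : ℚ) (f : X ⟶ X) : tr X (a • f) = a • tr X f := by
  simp only [tr, MonoidalLinear.smul_whiskerRight, Linear.smul_comp, Linear.comp_smul]

end LinearTrace

/-! ### Coset recursion for the antisymmetrizer -/

section Antisymmetrizer
variable {C : Type u} [Category.{v} C] [MonoidalCategory C] [SymmetricCategory C]

/-- A permutation of `n + 1` positions is given by the image of position `0` and a permutation
of the remaining positions. -/
def permEquiv (n : ℕ) : Equiv.Perm (Fin (n + 1)) ≃ Fin (n + 1) × Equiv.Perm (Fin n) where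
  toFun σ := (σ 0, permTail σ)
  -- The right factor is `p.2` extended by fixing `0`; the left one sends `0` to `k = p.1` and moves
  -- positions `1, …, k` one step to the front, as `moveHead` does. It is a cycle of length `k + 1`,
  -- whence the sign `(-1)^k` below.
  invFun p := p.1.cycleRange.symm * Equiv.Perm.decomposeFin.symm (0, p.2)
  left_inv σ := by
    ext i : 1
    refine Fin.cases ?_ (fun i => ?_) i
    · simp
    · simp [succAbove_permTail]
  right_inv p := by
    ext1
    · simp
    · exact permTail_unique _ _ fun i => by simp

lemma permEquiv_symm_zero (n : ℕ) (k : Fin (n + 1)) (τ : Equiv.Perm (Fin n)) :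
    (permEquiv n).symm (k, τ) 0 = k :=
  congrArg Prod.fst ((permEquiv n).apply_symm_apply (k, τ))

lemma permTail_permEquiv_symm (n : ℕ) (k : Fin (n + 1)) (τ : Equiv.Perm (Fin n)) :
    permTail ((permEquiv n).symm (k, τ)) = τ :=
  congrArg Prod.snd ((permEquiv n).apply_symm_apply (k, τ))

lemma sign_permEquiv_symm (n : ℕ) (k : Fin (n + 1)) (τ : Equiv.Perm (Fin n)) :
    ((Equiv.Perm.sign ((permEquiv n).symm (k, τ)) : ℤ) : ℚ) =
      (-1) ^ (k : ℕ) * ((Equiv.Perm.sign τ : ℤ) : ℚ) := by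
  have h : Equiv.Perm.sign ((permEquiv n).symm (k, τ)) =
      (-1) ^ (k : ℕ) * Equiv.Perm.sign τ := by
    change Equiv.Perm.sign (k.cycleRange.symm * Equiv.Perm.decomposeFin.symm (0, τ)) = _
    rw [Equiv.Perm.sign_mul, Equiv.Perm.sign_symm, Fin.sign_cycleRange,
      Equiv.Perm.decomposeFin.symm_sign, if_pos rfl, one_mul]
  rw [h]
  push_cast
  rfl

lemma permMap_permEquiv_symm (X : C) (n : ℕ) (k : Fin (n + 1)) (τ : Equiv.Perm (Fin n)) :
    permMap X (n + 1) ((permEquiv n).symm (k, τ)) = X ◁ permMap X n τ ≫ moveHead X n k := by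
  rw [permMap, permEquiv_symm_zero, permTail_permEquiv_symm]

lemma permMap_moveHead (X : C) (n : ℕ) (k : Fin (n + 1)) :
    permMap X (n + 1) ((permEquiv n).symm (k, 1)) = moveHead X n k := by
  rw [permMap_permEquiv_symm, permMap_one, MonoidalCategory.whiskerLeft_id]
  exact Category.id_comp _

/-- Unlike in `swapHead_naturality`, the first two factors may carry different endomorphisms, as is
needed when one of them is the distinguished `h`. -/
lemma swapHead_naturality_tensorHom {X T : C} (f h : X ⟶ X) (t : T ⟶ T) :
    (f ⊗ₘ (h ⊗ₘ t)) ≫ swapHead X T = swapHead X T ≫ (h ⊗ₘ (f ⊗ₘ t)) := by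
  simp only [swapHead, Category.assoc]
  rw [associator_inv_naturality_assoc, ← tensorHom_id, tensorHom_comp_tensorHom_assoc,
    BraidedCategory.braiding_naturality, Category.comp_id, ← associator_naturality,
    tensorHom_comp_tensorHom_assoc, Category.id_comp]

variable [Preadditive C] [Linear ℚ C]

lemma moveHead_antisymmetrizer (X : C) (n : ℕ) (k : Fin (n + 1)) :
    moveHead X n k ≫ antisymmetrizer X (n + 1) =
      ((-1) ^ (k : ℕ) : ℚ) • antisymmetrizer X (n + 1) := by
  rw [← permMap_moveHead, permMap_antisymmetrizer, sign_permEquiv_symm]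
  simp

variable [MonoidalPreadditive C] [MonoidalLinear ℚ C]

/-- The sum over permutations is split by the image `k` of position `0`; the inner sum over
permutations of the other positions is again an antisymmetrizer. -/
lemma antisymmetrizer_succ (X : C) (n : ℕ) : antisymmetrizer X (n + 1) =
    ((n + 1 : ℚ)⁻¹) • ∑ k : Fin (n + 1),
      ((-1) ^ (k : ℕ) : ℚ) • (X ◁ antisymmetrizer X n ≫ moveHead X n k) := by
  rw [antisymmetrizer, ← (permEquiv n).symm.sum_comp, Fintype.sum_prod_type, Nat.factorial_succ,
    Nat.cast_mul, mul_inv, mul_smul, Nat.cast_succ]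
  congr 1
  rw [Finset.smul_sum]
  refine Finset.sum_congr rfl fun k _ => ?_
  rw [antisymmetrizer, MonoidalLinear.whiskerLeft_smul, Linear.smul_comp,
    whiskerLeft_sum, Preadditive.sum_comp, smul_comm]
  congr 1
  rw [Finset.smul_sum]
  refine Finset.sum_congr rfl fun τ _ => ?_
  rw [sign_permEquiv_symm, permMap_permEquiv_symm, MonoidalLinear.whiskerLeft_smul,
    Linear.smul_comp, mul_smul]

end Antisymmetrizer

/-! ### Newton's relations for traces on exterior powers -/

section Newton
variable {C : Type u} [Category.{v} C] [Preadditive C] [Linear ℚ C] [MonoidalCategory C]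
  [SymmetricCategory C] [RightRigidCategory C]

/-- The trace of `f ⊗ ⋯ ⊗ f` on the `n`-th exterior power. -/
noncomputable def extTrace {X : C} (f : X ⟶ X) (n : ℕ) : End (𝟙_ C) :=
  tr (tensorPow X n) (antisymmetrizer X n ≫ tensorPowMap f n)

/-- The trace of `h ⊗ f ⊗ ⋯ ⊗ f`, composed with the antisymmetrizer. -/
noncomputable def hookTrace {X : C} (f h : X ⟶ X) (n : ℕ) : End (𝟙_ C) :=
  tr (tensorPow X (n + 1)) (antisymmetrizer X (n + 1) ≫ (h ⊗ₘ tensorPowMap f n))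

lemma tr_whiskerLeft_antisymmetrizer {X : C} (f h : X ⟶ X) (n : ℕ) :
    tr (tensorPow X (n + 1)) (X ◁ antisymmetrizer X n ≫ (h ⊗ₘ tensorPowMap f n)) =
      extTrace f n * tr X h := by
  rw [← id_tensorHom]
  refine (congrArg (tr _) (tensorHom_comp_tensorHom _ _ _ _)).trans ?_
  rw [Category.id_comp, tr_tensorHom, extTrace]
  exact endUnit_comp_comm _ _

/-- One loop runs through the head and the next factor, so it meets both `h` and one `f`;
contracting it merges them into `h ≫ f`. -/
lemma tr_swapHead_antisymmetrizer {X : C} (f h : X ⟶ X) (n : ℕ) :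
    tr (tensorPow X (n + 2)) (X ◁ antisymmetrizer X (n + 1) ≫ swapHead X (tensorPow X n) ≫
      (h ⊗ₘ tensorPowMap f (n + 1))) = hookTrace f (h ≫ f) n := by
  have e : swapHead X (tensorPow X n) ≫ (h ⊗ₘ tensorPowMap f (n + 1)) =
      X ◁ (h ⊗ₘ tensorPowMap f n) ≫ swapHead X (tensorPow X n) ≫
        X ◁ (f ▷ tensorPow X n) := by
    have e₁ := swapHead_naturality_tensorHom f (𝟙 X) (𝟙 (tensorPow X n))
    rw [id_tensorHom_id, tensorHom_id, id_tensorHom, tensorHom_id] at e₁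
    rw [← e₁]
    refine (swapHead_naturality_tensorHom f h (tensorPowMap f n)).symm.trans ?_
    rw [tensorHom_def', Category.assoc]
  rw [e]
  -- Rotating the last `f` to the front leaves a composite of the form `X ◁ u` followed by the swap,
  -- to which the contraction lemma applies. A second rotation then brings this `f` back next to
  -- `h`.
  have e₂ := tr_comp_comm (X ◁ antisymmetrizer X (n + 1) ≫ X ◁ (h ⊗ₘ tensorPowMap f n) ≫
    swapHead X (tensorPow X n)) (X ◁ (f ▷ tensorPow X n))
  simp only [Category.assoc] at e₂
  refine e₂.trans ?_
  have e₃ := tr_whiskerLeft_comp_swapHead (f ▷ tensorPow X n ≫ antisymmetrizer X (n + 1) ≫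
    (h ⊗ₘ tensorPowMap f n))
  simp only [MonoidalCategory.whiskerLeft_comp, Category.assoc] at e₃
  refine e₃.trans ?_
  rw [tr_comp_comm, hookTrace, Category.assoc]
  congr 2
  rw [← tensorHom_id]
  exact (tensorHom_comp_tensorHom _ _ _ _).trans (by rw [Category.comp_id])

variable [MonoidalPreadditive C] [MonoidalLinear ℚ C]

/-- After the initial swap, the rest of the move permutes only factors carrying `f`. It therefore
commutes with `h ⊗ f ⊗ ⋯ ⊗ f`, can be rotated around the trace, and is absorbed by the
antisymmetrizer at the cost of its sign. -/
lemma tr_moveHead_antisymmetrizer {X : C} (f h : X ⟶ X) (n : ℕ) (k : Fin (n + 1)) :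
    tr (tensorPow X (n + 2)) (X ◁ antisymmetrizer X (n + 1) ≫ moveHead X (n + 1) k.succ ≫
      (h ⊗ₘ tensorPowMap f (n + 1))) = ((-1) ^ (k : ℕ) : ℚ) • hookTrace f (h ≫ f) n := by
  have e : X ◁ moveHead X n k ≫ (h ⊗ₘ tensorPowMap f (n + 1)) =
      (h ⊗ₘ tensorPowMap f (n + 1)) ≫ X ◁ moveHead X n k := by
    rw [← id_tensorHom]
    refine (tensorHom_comp_tensorHom _ _ _ _).trans
      (Eq.trans ?_ (tensorHom_comp_tensorHom _ _ _ _).symm)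
    rw [Category.id_comp, Category.comp_id]
    exact congrArg _ (moveHead_naturality f n k).symm
  rw [← tr_swapHead_antisymmetrizer, ← tr_smul, moveHead_succ, Category.assoc, e]
  have e₂ := tr_comp_comm (X ◁ antisymmetrizer X (n + 1) ≫ swapHead X (tensorPow X n) ≫
    (h ⊗ₘ tensorPowMap f (n + 1))) (X ◁ moveHead X n k)
  simp only [Category.assoc] at e₂
  refine e₂.trans ?_
  rw [← Linear.smul_comp, ← MonoidalLinear.whiskerLeft_smul, ← moveHead_antisymmetrizer,
    MonoidalCategory.whiskerLeft_comp, Category.assoc]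

lemma hookTrace_zero {X : C} (f h : X ⟶ X) : hookTrace f h 0 = extTrace f 0 * tr X h := by
  rw [← tr_whiskerLeft_antisymmetrizer, hookTrace, antisymmetrizer_succ]
  simp [moveHead]

/-- In the coset recursion the term at `0` factors as a product of traces. Each of the `n + 1` terms
at `k.succ` has sign `(-1)^(k+1)` from the recursion and `(-1)^k` from the absorbed move, so all
contribute equally with coefficient `-1`. -/
lemma hookTrace_succ {X : C} (f h : X ⟶ X) (n : ℕ) :
    ((n : End (𝟙_ C)) + 2) * hookTrace f h (n + 1) =
      extTrace f (n + 1) * tr X h - (n + 1) * hookTrace f (h ≫ f) n := by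
  have key : hookTrace f h (n + 1) = ((n + 2 : ℚ)⁻¹) •
      (extTrace f (n + 1) * tr X h - ((n : ℚ) + 1) • hookTrace f (h ≫ f) n) := by
    rw [hookTrace, antisymmetrizer_succ, Linear.smul_comp, tr_smul]
    have hc : ((n + 1 : ℕ) : ℚ) + 1 = n + 2 := by push_cast; ring
    rw [hc, Preadditive.sum_comp, tr_sum, Fin.sum_univ_succ]
    congr 1
    have h₀ : tr (tensorPow X (n + 2)) ((((-1) ^ ((0 : Fin (n + 2)) : ℕ) : ℚ) •
        (X ◁ antisymmetrizer X (n + 1) ≫ moveHead X (n + 1) 0)) ≫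
          (h ⊗ₘ tensorPowMap f (n + 1))) = extTrace f (n + 1) * tr X h := by
      rw [← tr_whiskerLeft_antisymmetrizer, moveHead_zero]
      simp
    have h₁ : ∀ k : Fin (n + 1), tr (tensorPow X (n + 2)) ((((-1) ^ (k.succ : ℕ) : ℚ) •
        (X ◁ antisymmetrizer X (n + 1) ≫ moveHead X (n + 1) k.succ)) ≫
          (h ⊗ₘ tensorPowMap f (n + 1))) = -hookTrace f (h ≫ f) n := by
      intro k
      rw [Linear.smul_comp, tr_smul, Category.assoc, tr_moveHead_antisymmetrizer, smul_smul,
        Fin.val_succ, pow_succ, mul_right_comm, ← mul_pow]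
      simp
    rw [h₀, Finset.sum_congr rfl fun k _ => h₁ k]
    simp [← Nat.cast_smul_eq_nsmul ℚ, sub_eq_add_neg]
  have h₂ : ∀ (m : ℕ) (x : End (𝟙_ C)), (m : ℚ) • x = (m : End (𝟙_ C)) * x := fun m x =>
    (Nat.cast_smul_eq_nsmul ℚ m x).trans (nsmul_eq_mul m x)
  have h₃ := h₂ (n + 2) (hookTrace f h (n + 1))
  have h₄ := h₂ (n + 1) (hookTrace f (h ≫ f) n)
  push_cast at h₃ h₄
  rw [← h₃, ← h₄, key, smul_smul, mul_inv_cancel₀ (by positivity), one_smul]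

/-- The exponent `j` varies in the induction because each use of `hookTrace_succ` lowers `n` by one
and composes the distinguished factor with one more `f`. -/
lemma hookTrace_newton {X : C} (f : End X) (n j : ℕ) :
    ((n : End (𝟙_ C)) + 1) * hookTrace f (f ^ j : End X) n =
      ∑ p ∈ Finset.HasAntidiagonal.antidiagonal n,
        extTrace f p.1 * ((-1) ^ p.2 * tr X (f ^ (p.2 + j) : End X)) := by
  induction n generalizing j with
  | zero => simp [hookTrace_zero]
  | succ n ih =>
    have h₁ := hookTrace_succ f (f ^ j : End X) n
    have h₂ := ih (j + 1)
    have h₃ : (f ^ j : End X) ≫ f = (f ^ (j + 1) : End X) := (pow_succ' f j).symm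
    rw [h₃, h₂] at h₁
    rw [Finset.Nat.sum_antidiagonal_succ']
    push_cast
    rw [add_assoc, one_add_one_eq_two, h₁]
    simp only [pow_zero, one_mul, zero_add, sub_eq_add_neg, ← Finset.sum_neg_distrib]
    congr 1
    refine Finset.sum_congr rfl fun p _ => ?_
    rw [add_right_comm p.2 1 j, add_assoc p.2 j 1]
    ring

lemma extTrace_newton {X : C} (f : End X) (n : ℕ) :
    extTrace f (n + 1) * ((n : End (𝟙_ C)) + 1) =
      ∑ p ∈ Finset.HasAntidiagonal.antidiagonal n,
        extTrace f p.1 * ((-1) ^ p.2 * tr X (f ^ (p.2 + 1) : End X)) := by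
  rw [← hookTrace_newton f n 1, pow_one, mul_comm]
  -- With distinguished factor `f` itself, `hookTrace` in degree `n` is by definition `extTrace` in
  -- degree `n + 1`.
  rfl

end Newton

/-! ### Power sums of the characteristic series -/

section Character
variable {C : Type u} [Category.{v} C] [Preadditive C] [Linear ℚ C] [MonoidalCategory C]
  [SymmetricCategory C] [IsIdempotentComplete C] [RightRigidCategory C] {G : Type w} [Monoid G]

/-- Cyclicity moves the trace from the image of an idempotent to the whole tensor power, where
inclusion and projection compose to the antisymmetrizer. -/
lemma trRep_extPowRep (X : Action C G) (g : G) (n : ℕ) :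
    trRep (extPowRep n X) g = extTrace (X.ρ g) n := by
  change tr (extPow n X.V) (extPowIncl n X.V ≫ tensorPowMap (X.ρ g) n ≫ extPowProj n X.V) = _
  rw [tr_comp_comm, Category.assoc, extPowProj_incl, extTrace, tr_comp_comm]

variable [MonoidalPreadditive C] [MonoidalLinear ℚ C]

/-- The power sums of the characteristic series are the traces of the powers. -/
lemma isGhost_charSeries (X : Action C G) (g : G) :
    LambdaSeries.IsGhost (charSeries X g).series fun n => trRep X (g ^ n) := by
  rw [LambdaSeries.isGhost_iff]
  intro n
  have h : ∀ m, PowerSeries.coeff m (charSeries X g).series = extTrace (X.ρ g) m := fun m => by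
    rw [charSeries, PowerSeries.coeff_mk, trRep_extPowRep]
  simp only [h, trRep, map_pow]
  exact extTrace_newton (X.ρ g) n

lemma ghost_charSeries (X : Action C G) (g : G) {n : ℕ} (hn : n ≠ 0) :
    LambdaSeries.ghost (charSeries X g).series n = trRep X (g ^ n) :=
  ((isGhost_charSeries X g).eq_ghost (charSeries X g).constantCoeff_series hn).symm

end Character
end TensorCat

/-! ### Power sums of Adams operations, and the theorem -/

namespace LambdaSeries
universe u
open PowerSeries

variable {A : Type u} [CommRing A] [Algebra ℚ A]

/-- The power sum of index `m`, as a ring homomorphism on `Λ(A)`. -/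
noncomputable def BigLambda.ghostHom (m : ℕ) (hm : m ≠ 0) : BigLambda A →+* A where
  toFun f := ghost f.series m
  map_one' := BigLambda.ghost_one hm
  map_mul' f g := BigLambda.ghost_mul f g hm
  map_zero' := BigLambda.ghost_zero hm
  map_add' f g := BigLambda.ghost_add f g hm

/-- The power sums of `ψ_n f` are `w_n f, w_{2n} f, …`. -/
lemma ghost_adams (n : ℕ) (hn : n ≠ 0) (f : BigLambda A) (m : ℕ) (hm : m ≠ 0) :
    ghost (LambdaRing.adams n f).series m = ghost f.series (m * n) := by
  have hc : constantCoeff (LambdaRing.lamSeries f) = 1 := by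
    rw [← coeff_zero_eq_constantCoeff_apply, LambdaRing.lamSeries, coeff_mk,
      LambdaRing.lam_zero]
  have h := map_ghost (BigLambda.ghostHom m hm) hc hn
  -- By definition `LambdaRing.adams n f` is the `n`-th power sum of the series of the `λ^j f`,
  -- taken over the ring `Λ(A)`; hence the ring homomorphism `w_m` can be applied to the
  -- coefficients first.
  refine h.symm.trans ?_
  have e : PowerSeries.map (BigLambda.ghostHom m hm) (LambdaRing.lamSeries f) =
      ofGhost fun k => ghost f.series (m * k) := by
    ext j
    rw [coeff_map, LambdaRing.lamSeries, coeff_mk]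
    change ghost (BigLambda.lamOp j f).series m = _
    rw [BigLambda.series_lamOp, ← (isGhost_ofGhost _).eq_ghost (constantCoeff_ofGhost _) hm]
  rw [e, ← (isGhost_ofGhost _).eq_ghost (constantCoeff_ofGhost _) hn]

end LambdaSeries

theorem mainTheorem2 {C : Type*} [Category C] [Preadditive C] [Linear ℚ C]
    [MonoidalCategory C] [SymmetricCategory C] [MonoidalPreadditive C] [MonoidalLinear ℚ C]
    [IsIdempotentComplete C] [RightRigidCategory C] {G : Type*} [Monoid G]
    (X : Action C G) (g : G) :
    (∀ n : ℕ, 1 ≤ n → TensorCat.charSeries X (g ^ n) =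
      LambdaSeries.LambdaRing.adams n (TensorCat.charSeries X g)) ∧
    LambdaSeries.negLogDeriv (TensorCat.charSeries X g).series =
      PowerSeries.mk fun n => if n = 0 then 0 else (-1) ^ n * TensorCat.trRep X (g ^ n) := by
  refine ⟨fun n hn => LambdaSeries.BigLambda.ext_ghost fun m hm => ?_, ?_⟩
  · have hn' : n ≠ 0 := by omega
    rw [LambdaSeries.ghost_adams n hn' _ m hm, TensorCat.ghost_charSeries X _ hm,
      TensorCat.ghost_charSeries X g (Nat.mul_ne_zero hm hn'), ← pow_mul, mul_comm]
  · ext n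
    rw [PowerSeries.coeff_mk]
    split_ifs with h
    -- The coefficient at `0`, which no power sum controls, vanishes because of the factor `X` in
    -- front of the derivative.
    · subst h
      simp [LambdaSeries.negLogDeriv]
    · rw [← TensorCat.ghost_charSeries X g h, LambdaSeries.ghost,
        LambdaSeries.neg_one_pow_mul_self_mul]
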